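/- All logarithms are to base $2$. For a graph $G$ and $X\subseteq V(G)$, let $N_G(X)$ be the set of vertices outside $X$ that have at least one neighbour in $X$. An $n$-vertex graph $G$ is an $(\varepsilon,c,s)$-expander if for all $U\subseteq V(G)$ and $F\subseteq E(G)$ with $1\le |U|\le \frac23 n$ and $|F|\le s|U|$ one has $|N_{G-F}(U)|\ge \frac{\varepsilon}{(\log n)^c}|U|$. **Lemma.** There is an absolute constant $n_0$ such that the following holds. Let $2^{-9}\le\varepsilon<1$, $c>0$, $0<q<1$, $n\ge n_0$ and $s\ge \frac{2(\log n)^{9c+21}}{q^{10}}$. Let $G$ be an $n$-vertex $(\varepsilon,c,s)$-expander, and let $V$ be a random subset of $V(G)$ obtained by including each vertex independently with probability $q$. Then, with probability at least $1-\frac1n$, the following holds for every $r\ge 0$ simultaneously. If $x_1,\dots,x_r,y_1,\dots,y_r$ are (pairwise) distinct vertices not contained in $V$ such that $$|N_G(X)|\ge \frac{100(\log n)^{7c+19}}{q^6}\,|X|\qquad\text{for every } X\subseteq\{x_1,\dots,x_r,y_1,\dots,y_r\},$$ then there are paths $P_1,\dots,P_r$ in $G$, each of length at most $(\log n)^{c+4}$,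 such that for each $i$ the path $P_i$ goes from $x_i$ to $y_i$ and has all its internal vertices in $V$, and $P_1,\dots,P_r$ are pairwise vertex-disjoint. -/

import Mathlib

namespace SublinearExpander

/-- `N_G(U)`: the vertices outside `U` that are adjacent to at least one vertex of `U`. -/
def outerNeighbors {W : Type*} (G : SimpleGraph W) (U : Set W) : Set W :=
  {v | v ∉ U ∧ ∃ u ∈ U, G.Adj u v}

/-- `(ε, c, s)`-expander; the logarithm is to base 2, and `G.deleteEdges F` is `G - F`. -/
def IsExpander {W : Type*} [Fintype W] (G : SimpleGraph W) (ε c s : ℝ) : Prop :=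
  ∀ (U : Set W) (F : Set (Sym2 W)), F ⊆ G.edgeSet →
    1 ≤ U.ncard → (U.ncard : ℝ) ≤ 2 / 3 * (Fintype.card W : ℝ) →
    (F.ncard : ℝ) ≤ s * (U.ncard : ℝ) →
    ε / (Real.logb 2 (Fintype.card W : ℝ)) ^ c * (U.ncard : ℝ) ≤
      ((outerNeighbors (G.deleteEdges F) U).ncard : ℝ)

/-- `x i` and `y i`, for all `i < r`, can be joined by pairwise vertex-disjoint paths of length at
most `L` all of whose internal vertices lie in `V`. -/
def JoinedThrough {W : Type*} (G : SimpleGraph W) (V : Set W) (L : ℝ) {r : ℕ}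
    (x y : Fin r → W) : Prop :=
  ∃ P : ∀ i : Fin r, G.Walk (x i) (y i),
    (∀ i, (P i).IsPath) ∧
    (∀ i, ((P i).length : ℝ) ≤ L) ∧
    (∀ i, ∀ v ∈ (P i).support, v ≠ x i → v ≠ y i → v ∈ V) ∧
    (∀ i j, i ≠ j → ∀ v ∈ (P i).support, v ∉ (P j).support)

end SublinearExpander

/-!
Split the random set into `M` independent rounds and let `reach` grow by one step per round. As the
expansion is robust under deleting few edges, the boundary of a set `R` contains a bipartite graph
of bounded degree from `R`, so by the bounded difference inequality exposing a random part of `R`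
reaches a proportional part of the boundary outside any small forbidden set `Z`; a union bound over
`X` and `Z` makes this hold simultaneously for all of them. Hence a set with many neighbours reaches
more than two thirds of the graph, and halving it repeatedly, keeping the half that reaches more,
yields a single vertex which does. For more than half of the pairs in any subfamily both ends are
such vertices, so some pair is joined while avoiding `Z`. With `Z` the union of the paths chosen so
far, this is precisely the domination condition in Haxell's theorem on independent transversals,
which then selects disjoint paths for all pairs at once.
-/

namespace SublinearExpander

open MeasureTheory ProbabilityTheory unitInterval

section RandomSets

variable {ι : Type*} [Finite ι] {T : Set ι} {p : I}

theorem integral_setBernoulli_coe (T : Finset ι) (p : I) (f : Set ι → ℝ) :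
    ∫ V, f V ∂setBer((T : Set ι), p) =
      ∑ V ∈ T.powerset, (p : ℝ) ^ V.card * (1 - p) ^ (T.card - V.card) * f V := by
  classical
  have := Fintype.ofFinite ι
  rw [integral_fintype .of_finite, ← Finset.sum_subset
    (Finset.subset_univ (T.powerset.map ⟨(↑), Finset.coe_injective⟩)), Finset.sum_map]
  · refine Finset.sum_congr rfl fun V hV ↦ ?_
    have hVT : V ⊆ T := Finset.mem_powerset.mp hV
    simp only [Function.Embedding.coeFn_mk, smul_eq_mul]
    rw [setBernoulli_real_singleton p (Finset.coe_subset.mpr hVT) T.finite_toSet,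
      ← Finset.coe_sdiff, Set.ncard_coe_finset, Set.ncard_coe_finset,
      Finset.card_sdiff_of_subset hVT]
  · intro V _ hV
    have hVT : ¬ V ⊆ T := fun hVT ↦ hV <| Finset.mem_map.mpr
      ⟨V.toFinset, by simpa [Set.toFinset_subset] using hVT, by simp⟩
    simp [Measure.real, setBernoulli_singleton_of_not_subset p hVT]

theorem integral_setBernoulli_insert {a : ι} (ha : a ∉ T) (f : Set ι → ℝ) :
    ∫ V, f V ∂setBer(insert a T, p) =
      (1 - p) * ∫ V, f V ∂setBer(T, p) + p * ∫ V, f (insert a V) ∂setBer(T, p) := by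
  classical
  lift T to Finset ι using T.toFinite
  replace ha : a ∉ T := ha
  rw [← Finset.coe_insert]
  simp only [integral_setBernoulli_coe]
  rw [Finset.sum_powerset_insert ha, Finset.mul_sum, Finset.mul_sum]
  congr 1 <;> refine Finset.sum_congr rfl fun V hV ↦ ?_ <;>
    have hVT : V ⊆ T := Finset.mem_powerset.mp hV
  · rw [Finset.card_insert_of_notMem ha, Nat.succ_sub (Finset.card_le_card hVT), pow_succ]
    ring
  · rw [Finset.card_insert_of_notMem (fun h ↦ ha (hVT h)), Finset.card_insert_of_notMem ha,
      Nat.add_sub_add_right, pow_succ, Finset.coe_insert]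
    ring

theorem setBernoulli_real_insert {a : ι} (ha : a ∉ T) (E : Set (Set ι)) :
    setBer(insert a T, p).real E =
      (1 - p) * setBer(T, p).real E + p * setBer(T, p).real {V | insert a V ∈ E} := by
  simp only [← integral_indicator_one (Set.toFinite _).measurableSet]
  exact integral_setBernoulli_insert ha _

theorem setBernoulli_real_disjoint (T N : Set ι) :
    setBer(T, p).real {V | Disjoint N V} = (1 - p) ^ (N ∩ T).ncard := by
  induction T, T.toFinite using Set.Finite.induction_on with
  | empty => simp [setBernoulli_empty, Measure.real]
  | @insert a T ha _ ih =>
    rw [setBernoulli_real_insert ha, ih]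
    simp only [Set.mem_ofPred_eq, Set.disjoint_insert_right]
    by_cases haN : a ∈ N
    · rw [Set.inter_insert_of_mem haN, Set.ncard_insert_of_notMem fun h ↦ ha h.2, pow_succ]
      simp [haN, mul_comm]
    · rw [Set.inter_insert_of_notMem haN]
      simp only [haN, not_false_eq_true, true_and, ih]
      ring

/-- Sprinkling: a random set may be exposed as the union of two independent sparser ones. -/
theorem integral_setBernoulli_eq_integral_union (T : Set ι) {a b : I} (h : σ p = σ a * σ b)
    (f : Set ι → ℝ) :
    ∫ V, f V ∂setBer(T, p) = ∫ A, ∫ B, f (A ∪ B) ∂setBer(T, b) ∂setBer(T, a) := by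
  have hσ : (1 - p : ℝ) = (1 - a) * (1 - b) := congrArg Subtype.val h
  have hp : (p : ℝ) = 1 - (1 - a) * (1 - b) := by rw [← hσ, sub_sub_cancel]
  induction T, T.toFinite using Set.Finite.induction_on generalizing f with
  | empty => simp [setBernoulli_empty]
  | insert hx _ ih =>
    simp only [integral_setBernoulli_insert hx, ih, Set.insert_union, Set.union_insert,
      Set.insert_idem, integral_add .of_finite .of_finite, integral_const_mul, hp]
    ring

theorem setBernoulli_real_le_add_of_union {a b : I} (h : σ p = σ a * σ b) {E F : Set (Set ι)}
    {x δ : ℝ} (hδ : 0 ≤ δ) (hE : setBer(T, a).real E ≤ x)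
    (hF : ∀ A ∉ E, setBer(T, b).real {B | A ∪ B ∈ F} ≤ δ) : setBer(T, p).real F ≤ x + δ := by
  have hmeas (S : Set (Set ι)) : MeasurableSet S := S.toFinite.measurableSet
  have hreal (A : Set ι) :
      ∫ B, F.indicator 1 (A ∪ B) ∂setBer(T, b) = setBer(T, b).real {B | A ∪ B ∈ F} :=
    integral_indicator_one (μ := setBer(T, b)) (hmeas {B | A ∪ B ∈ F})
  calc setBer(T, p).real F
      = ∫ A, setBer(T, b).real {B | A ∪ B ∈ F} ∂setBer(T, a) := by
        rw [← integral_indicator_one (hmeas F), integral_setBernoulli_eq_integral_union T h]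
        simp only [hreal]
    _ ≤ ∫ A, (E.indicator 1 A + δ) ∂setBer(T, a) := by
        refine integral_mono .of_finite .of_finite fun A ↦ ?_
        by_cases hA : A ∈ E
        · simpa [hA] using measureReal_le_one.trans (le_add_of_nonneg_right hδ)
        · simpa [hA] using hF A hA
    _ ≤ x + δ := by
        rw [integral_add .of_finite .of_finite, integral_indicator_one (hmeas E)]
        simpa using hE

theorem bernoulli_exp_le (p : I) (x y : ℝ) :
    (1 - p) * Real.exp x + p * Real.exp y ≤
      Real.exp ((1 - p) * x + p * y + (y - x) ^ 2 / 8) := by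
  classical
  let X : Set Unit → ℝ := fun V ↦ if () ∈ V then y else x
  have integral_eq (g : ℝ → ℝ) :
      ∫ V, g (X V) ∂setBer(insert () ∅, p) = (1 - p) * g x + p * g y := by
    rw [integral_setBernoulli_insert (Set.notMem_empty ())]
    simp [setBernoulli_empty, X]
  have hX : ∀ V, X V ∈ Set.Icc (min x y) (max x y) := by
    intro V
    by_cases hV : () ∈ V <;> simp [X, hV]
  have hmgf := (hasSubgaussianMGF_of_mem_Icc (μ := setBer(insert () ∅, p))
    (Measurable.of_discrete (f := X)).aemeasurable (.of_forall hX)).mgf_le 1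
  have hmean := integral_eq id
  simp only [id_eq] at hmean
  simp only [mgf, hmean, integral_eq fun z ↦ Real.exp (1 * (z - ((1 - p) * x + p * y)))] at hmgf
  calc _ = Real.exp ((1 - p) * x + p * y) * ((1 - p) * Real.exp (1 * (x - ((1 - p) * x + p * y))) +
        p * Real.exp (1 * (y - ((1 - p) * x + p * y)))) := by
        simp only [one_mul, mul_add, mul_left_comm (Real.exp _), ← Real.exp_add,
          add_sub_cancel]
    _ ≤ Real.exp ((1 - p) * x + p * y) *
          Real.exp (((‖max x y - min x y‖₊ / 2) ^ 2 : NNReal) * 1 ^ 2 / 2) := by gcongr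
    _ = _ := by
      rw [← Real.exp_add, max_sub_min_eq_abs]
      push_cast
      rw [Real.norm_eq_abs, abs_abs, div_pow, sq_abs]
      ring_nf

theorem integral_exp_setBernoulli_le_of_bounded_differences (T : Finset ι) (p : I)
    {c : ι → ℝ} {f : Set ι → ℝ} (hf : ∀ a V, |f (insert a V) - f V| ≤ c a) :
    ∫ V, Real.exp (f V) ∂setBer((T : Set ι), p) ≤
      Real.exp (∫ V, f V ∂setBer((T : Set ι), p) + (∑ a ∈ T, c a ^ 2) / 8) := by
  classical
  induction T using Finset.induction_on generalizing f with
  | empty => simp [setBernoulli_empty]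
  | @insert a T ha ih =>
    have hf' : ∀ b V, |f (insert a (insert b V)) - f (insert a V)| ≤ c b := fun b V ↦ by
      simpa only [Set.insert_comm] using hf b (insert a V)
    set m₀ := ∫ V, f V ∂setBer((T : Set ι), p)
    set m₁ := ∫ V, f (insert a V) ∂setBer((T : Set ι), p)
    have hm : |m₁ - m₀| ≤ c a := by
      rw [← integral_sub .of_finite .of_finite]
      simpa using norm_integral_le_of_norm_le_const (μ := setBer((T : Set ι), p))
        (f := fun V ↦ f (insert a V) - f V) (.of_forall (hf a))
    simp only [Finset.coe_insert, integral_setBernoulli_insert (Finset.mem_coe.not.mpr ha)]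
    calc _ ≤ (1 - p : ℝ) * Real.exp (m₀ + (∑ a ∈ T, c a ^ 2) / 8) +
          p * Real.exp (m₁ + (∑ a ∈ T, c a ^ 2) / 8) := by
            gcongr
            · exact unitInterval.one_minus_nonneg p
            · exact ih hf
            · exact unitInterval.nonneg p
            · exact ih hf'
      _ ≤ Real.exp (((1 - p) * m₀ + p * m₁ + (m₁ - m₀) ^ 2 / 8) + (∑ a ∈ T, c a ^ 2) / 8) := by
        rw [Real.exp_add m₀, Real.exp_add m₁, Real.exp_add (_ + (m₁ - m₀) ^ 2 / 8), ← mul_assoc,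
          ← mul_assoc, ← add_mul]
        gcongr
        exact bernoulli_exp_le p m₀ m₁
      _ ≤ _ := by
        rw [Finset.sum_insert ha, add_div, ← add_assoc _ (c a ^ 2 / 8), ← sq_abs (m₁ - m₀)]
        gcongr

/-- McDiarmid's inequality for functions of a Bernoulli random set. -/
theorem hasSubgaussianMGF_setBernoulli_of_bounded_differences (T : Finset ι) (p : I)
    {c : ι → NNReal} {f : Set ι → ℝ} (hf : ∀ a V, |f (insert a V) - f V| ≤ c a) :
    HasSubgaussianMGF (fun V ↦ f V - ∫ U, f U ∂setBer((T : Set ι), p)) ((∑ a ∈ T, c a ^ 2) / 4)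
      setBer((T : Set ι), p) where
  integrable_exp_mul _ := .of_finite
  mgf_le t := by
    have htf : ∀ a V, |t * f (insert a V) - t * f V| ≤ |t| * c a := fun a V ↦ by
      rw [← mul_sub, abs_mul]
      gcongr
      exact hf a V
    calc
      mgf _ _ t = Real.exp (-(t * ∫ V, f V ∂setBer((T : Set ι), p))) *
          ∫ V, Real.exp (t * f V) ∂setBer((T : Set ι), p) := by
        rw [mgf, ← integral_const_mul]
        simp only [← Real.exp_add, mul_sub, neg_add_eq_sub]
      _ ≤ Real.exp (-(t * ∫ V, f V ∂setBer((T : Set ι), p))) *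
          Real.exp (∫ V, t * f V ∂setBer((T : Set ι), p) + (∑ a ∈ T, (|t| * c a) ^ 2) / 8) := by
        gcongr
        exact integral_exp_setBernoulli_le_of_bounded_differences T p htf
      _ = _ := by
        simp only [← Real.exp_add, integral_const_mul, mul_pow, sq_abs, ← Finset.mul_sum]
        push_cast
        ring_nf

theorem setBernoulli_real_le_integral_sub_le (T : Finset ι) (p : I)
    {c : ι → NNReal} {f : Set ι → ℝ} (hf : ∀ a V, |f (insert a V) - f V| ≤ c a) {s : ℝ}
    (hs : 0 ≤ s) :
    setBer((T : Set ι), p).real {V | f V ≤ ∫ U, f U ∂setBer((T : Set ι), p) - s} ≤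
      Real.exp (-2 * s ^ 2 / ∑ a ∈ T, c a ^ 2) := by
  refine (le_of_eq ?_).trans
    ((hasSubgaussianMGF_setBernoulli_of_bounded_differences T p hf).neg.measure_ge_le hs)
      |>.trans_eq ?_
  · congr 1
    ext V
    simp [le_sub_comm]
  · push_cast
    congr 1
    ring

end RandomSets

section UnionBound

variable {W κ : Type*} [Fintype W]

theorem sum_pow_ncard_le_exp {y : ℝ} (hy : 0 ≤ y) :
    ∑ X : Set W, y ^ X.ncard ≤ Real.exp (Fintype.card W * y) := by
  classical
  have h : ∑ X : Set W, y ^ X.ncard = ∑ X : Finset W, y ^ X.card := by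
    rw [← Fintype.finsetEquivSet.sum_comp]
    simp
  have := Fintype.sum_pow_mul_eq_add_pow W y 1
  simp only [one_pow, mul_one] at this
  rw [h, this, Real.exp_nat_mul]
  gcongr
  exact Real.add_one_le_exp y

theorem measureReal_iUnion_le_mul_exp [Fintype κ] {Ω : Type*} [MeasurableSpace Ω] (μ : Measure Ω)
    {y : ℝ} (hy : 0 ≤ y) {E : (κ → Set W) → Set Ω}
    (hE : ∀ X, μ.real (E X) ≤ y ^ (1 + ∑ i, (X i).ncard)) :
    μ.real (⋃ X, E X) ≤ y * Real.exp (Fintype.card κ * Fintype.card W * y) := by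
  classical
  calc
    μ.real (⋃ X, E X) ≤ ∑ X, μ.real (E X) := measureReal_iUnion_fintype_le E
    _ ≤ ∑ X : κ → Set W, y ^ (1 + ∑ i, (X i).ncard) := Finset.sum_le_sum fun X _ ↦ hE X
    _ = y * ∏ _i : κ, ∑ X : Set W, y ^ X.ncard := by
      rw [Finset.prod_univ_sum, Fintype.piFinset_univ, Finset.mul_sum]
      simp only [pow_add, pow_one, Finset.prod_pow_eq_pow_sum]
    _ ≤ y * ∏ _i : κ, Real.exp (Fintype.card W * y) := by
      gcongr with i
      exact sum_pow_ncard_le_exp hy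
    _ = _ := by
      rw [Finset.prod_const, Finset.card_univ, ← Real.exp_nat_mul, mul_assoc]

end UnionBound

section IndependentTransversals

variable {ι V : Type*} {F : ι → Set V} {R : V → V → Prop} {J S : Finset ι} {D : Finset V}
  {T T' T'' : ι → V} {i : ι} {x y : V}

/-- `T` picks a member of `F i` for every `i ∈ J`, and no two of these members are related. -/
structure IsIndepTransversal (F : ι → Set V) (R : V → V → Prop) (J : Finset ι) (T : ι → V) :
    Prop where
  mem : ∀ i ∈ J, T i ∈ F i
  not_rel : ∀ i ∈ J, ∀ j ∈ J, i ≠ j → ¬ R (T i) (T j)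

/-- Members of `D` are not related to `v`. -/
def IsUndominated (R : V → V → Prop) (D : Finset V) (v : V) : Prop :=
  ∀ u ∈ D, ¬ R u v

/-- `T'` is an independent transversal obtained from `T` by changing only entries outside `S`, and
only to members undominated by `D`. -/
structure IsModification (F : ι → Set V) (R : V → V → Prop) (J S : Finset ι) (D : Finset V)
    (T T' : ι → V) : Prop extends IsIndepTransversal F R J T' where
  eq_of_mem : ∀ i ∈ S, T' i = T i
  isUndominated : ∀ i, T' i ≠ T i → IsUndominated R D (T' i)

theorem IsUndominated.mono {D' : Finset V} (h : IsUndominated R D' x) (hD : D ⊆ D') :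
    IsUndominated R D x :=
  fun u hu ↦ h u (hD hu)

theorem IsIndepTransversal.update [DecidableEq ι] [Std.Symm R]
    (hT : IsIndepTransversal F R J T) (hy : y ∈ F i) (hyT : ∀ j ∈ J, j ≠ i → ¬ R (T j) y) :
    IsIndepTransversal F R (insert i J) (Function.update T i y) where
  mem j hj := by
    obtain rfl | hji := eq_or_ne j i
    · simpa using hy
    · simpa [hji] using hT.mem j (Finset.mem_of_mem_insert_of_ne hj hji)
  not_rel j hj k hk hjk := by
    obtain rfl | hji := eq_or_ne j i
    · have hkJ := Finset.mem_of_mem_insert_of_ne hk hjk.symm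
      simpa [hjk.symm] using fun h ↦ hyT k hkJ hjk.symm (symm h)
    · have hjJ := Finset.mem_of_mem_insert_of_ne hj hji
      obtain rfl | hki := eq_or_ne k i
      · simpa [hji] using hyT j hjJ hji
      · simpa [hji, hki] using hT.not_rel j hjJ k (Finset.mem_of_mem_insert_of_ne hk hki) hjk

theorem IsModification.refl (hT : IsIndepTransversal F R J T) : IsModification F R J S D T T :=
  ⟨hT, fun _ _ ↦ rfl, fun _ h ↦ (h rfl).elim⟩

theorem IsModification.trans {S' : Finset ι} {D' : Finset V} (h : IsModification F R J S D T T')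
    (h' : IsModification F R J S' D' T' T'') (hS : S ⊆ S') (hD : D ⊆ D') :
    IsModification F R J S D T T'' where
  toIsIndepTransversal := h'.toIsIndepTransversal
  eq_of_mem i hi := (h'.eq_of_mem i (hS hi)).trans (h.eq_of_mem i hi)
  isUndominated i hi := by
    by_cases hi' : T'' i = T' i
    · rw [hi'] at hi ⊢
      exact h.isUndominated i hi
    · exact (h'.isUndominated i hi').mono hD

theorem IsModification.update [DecidableEq ι] [Std.Symm R]
    (h : IsModification F R J S D T T') (hiJ : i ∈ J) (hiS : i ∉ S) (hy : y ∈ F i)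
    (hyD : IsUndominated R D y) (hyT : ∀ j ∈ J, ¬ R (T' j) y) :
    IsModification F R J S D T (Function.update T' i y) where
  toIsIndepTransversal := by
    simpa [hiJ] using h.toIsIndepTransversal.update hy fun j hj _ ↦ hyT j hj
  eq_of_mem j hj := by
    rw [Function.update_of_ne (ne_of_mem_of_not_mem hj hiS)]
    exact h.eq_of_mem j hj
  isUndominated j hj := by
    obtain rfl | hji := eq_or_ne j i
    · simpa using hyD
    · rw [Function.update_of_ne hji] at hj ⊢
      exact h.isUndominated j hj

open scoped Classical in
/-- The indices in `J` at which `T` conflicts with the candidate `x`. -/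
noncomputable def conflicts (R : V → V → Prop) (J : Finset ι) (T : ι → V) (x : V) : Finset ι :=
  {i ∈ J | R (T i) x}

theorem mem_conflicts : i ∈ conflicts R J T x ↔ i ∈ J ∧ R (T i) x := by
  classical simp [conflicts]

theorem IsModification.conflicts_update_ssubset [DecidableEq ι] [Std.Symm R]
    {S' : Finset ι} {D' : Finset V} (h : IsModification F R J S' D' T T') (hxD : x ∈ D')
    (hi : i ∈ conflicts R J T x) (hy : ¬ R x y) :
    conflicts R J (Function.update T' i y) x ⊂ conflicts R J T x := by
  have hsub : ∀ j ∈ conflicts R J (Function.update T' i y) x, j ≠ i ∧ j ∈ conflicts R J T x := by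
    intro j hj
    obtain ⟨hjJ, hjx⟩ := mem_conflicts.mp hj
    have hji : j ≠ i := by
      rintro rfl
      exact hy (symm (by simpa using hjx : R y x))
    rw [Function.update_of_ne hji] at hjx
    have hTj : T' j = T j := by
      by_contra hne
      exact h.isUndominated j hne x hxD (symm hjx)
    exact ⟨hji, mem_conflicts.mpr ⟨hjJ, hTj ▸ hjx⟩⟩
  exact (Finset.ssubset_iff_of_subset fun j hj ↦ (hsub j hj).2).mpr
    ⟨i, hi, fun hi' ↦ (hsub i hi').1 rfl⟩

/-- The hypothesis of Haxell's theorem on independent transversals: every nonempty `S` has some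
`F i`, `i ∈ S`, that is not dominated by `2 (#S - 1)` elements. -/
def HaxellCondition (F : ι → Set V) (R : V → V → Prop) : Prop :=
  ∀ (S : Finset ι) (D : Finset V), S.Nonempty → D.card ≤ 2 * (S.card - 1) →
    ∃ i ∈ S, ∃ v ∈ F i, IsUndominated R D v

theorem card_insert_union_image_le [DecidableEq ι] [DecidableEq V] {N : Finset ι} (x : V)
    (T : ι → V) (hS : S.Nonempty) (hN : N.Nonempty) (hSN : Disjoint S N)
    (hD : D.card ≤ 2 * (S.card - 1)) :
    (insert x (D ∪ N.image T)).card ≤ 2 * ((S ∪ N).card - 1) := by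
  have h₁ := Finset.card_insert_le x (D ∪ N.image T)
  have h₂ := Finset.card_union_le D (N.image T)
  have h₃ := Finset.card_image_le (s := N) (f := T)
  have h₄ := Finset.card_union_of_disjoint hSN
  have := hS.card_pos
  have := hN.card_pos
  omega

/-- Local search: a modification with the fewest conflicts with an undominated `x` is kept, and its
conflicting indices `N` are added to `S`. The `y` that induction provides either belongs to `S`, or
it belongs to `N` and replacing the conflicting entry by `y` would leave fewer conflicts. -/
theorem HaxellCondition.exists_isModification_not_rel (hF : HaxellCondition F R)
    [Std.Symm R] (hS : S.Nonempty) (hD : D.card ≤ 2 * (S.card - 1))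
    (hT : IsIndepTransversal F R J T) (hTD : ∀ i ∈ S, i ∈ J → T i ∈ D) :
    ∃ T', IsModification F R J S D T T' ∧
      ∃ i ∈ S, ∃ y ∈ F i, IsUndominated R D y ∧ ∀ j ∈ J, ¬ R (T' j) y := by
  classical
  induction hk : (J \ S).card using Nat.strong_induction_on generalizing S D T with
  | _ k ih =>
  obtain ⟨i₀, hi₀, x, hx, hxD⟩ := hF S D hS hD
  obtain ⟨T₁, hT₁, hmin⟩ : ∃ T₁, IsModification F R J S D T T₁ ∧ ∀ T₂,
      IsModification F R J S D T T₂ → (conflicts R J T₁ x).card ≤ (conflicts R J T₂ x).card :=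
    exists_minimalFor_of_wellFoundedLT _ _ ⟨T, .refl hT⟩ |>.imp fun _ h ↦
      ⟨h.1, fun T₂ h₂ ↦ (le_total _ _).elim id (h.2 h₂)⟩
  set N := conflicts R J T₁ x
  obtain hN₀ | hN₀ := N.eq_empty_or_nonempty
  · refine ⟨T₁, hT₁, i₀, hi₀, x, hx, hxD, fun j hj hjx ↦ ?_⟩
    exact Finset.notMem_empty j (hN₀ ▸ mem_conflicts.mpr ⟨hj, hjx⟩)
  have hNJ : ∀ j ∈ N, j ∈ J := fun j hj ↦ (mem_conflicts.mp hj).1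
  have hNS : Disjoint S N := Finset.disjoint_left.mpr fun j hjS hjN ↦ by
    obtain ⟨hjJ, hjx⟩ := mem_conflicts.mp hjN
    exact hxD _ (hTD j hjS hjJ) (hT₁.eq_of_mem j hjS ▸ hjx)
  have hDD : D ⊆ insert x (D ∪ N.image T₁) := by grind
  have hlt : (J \ (S ∪ N)).card < k := by
    obtain ⟨j, hj⟩ := hN₀
    refine hk ▸ Finset.card_lt_card (Finset.ssubset_iff_of_subset (by grind) |>.mpr ⟨j, ?_, ?_⟩)
    · exact Finset.mem_sdiff.mpr ⟨hNJ j hj, Finset.disjoint_right.mp hNS hj⟩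
    · simp [hj]
  obtain ⟨T₂, hT₂, i, hi, y, hy, hyD, hyT⟩ :=
    ih _ hlt (hS.mono Finset.subset_union_left)
      (card_insert_union_image_le x T₁ hS hN₀ hNS hD) hT₁.toIsIndepTransversal
      (by have := hT₁.eq_of_mem; grind) rfl
  have hT₂' := hT₁.trans hT₂ Finset.subset_union_left hDD
  by_cases hiS : i ∈ S
  · exact ⟨T₂, hT₂', i, hiS, y, hy, hyD.mono hDD, hyT⟩
  have hiN : i ∈ N := (Finset.mem_union.mp hi).resolve_left hiS
  have hU := hT₂'.update (hNJ i hiN) hiS hy (hyD.mono hDD) hyT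
  have hss := hT₂.conflicts_update_ssubset (by simp) hiN (hyD x (by simp))
  exact absurd (hmin _ hU) (Finset.card_lt_card hss).not_ge

theorem HaxellCondition.exists_transversal [Finite ι] (hF : HaxellCondition F R)
    [Std.Symm R] : ∃ T : ι → V, (∀ i, T i ∈ F i) ∧ ∀ i j, i ≠ j → ¬ R (T i) (T j) := by
  classical
  have := Fintype.ofFinite ι
  suffices h : ∀ J : Finset ι, ∃ T, IsIndepTransversal F R J T by
    obtain ⟨T, hT⟩ := h Finset.univ
    exact ⟨T, by simpa using hT.mem, by simpa using hT.not_rel⟩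
  intro J
  induction J using Finset.induction_on with
  | empty =>
    have hne : ι → Nonempty V := fun i ↦ by
      obtain ⟨-, -, v, -⟩ := hF {i} ∅ (Finset.singleton_nonempty i) (by simp)
      exact ⟨v⟩
    exact ⟨fun i ↦ (hne i).some, by simp, by simp⟩
  | insert a J ha ih =>
    obtain ⟨T, hT⟩ := ih
    obtain ⟨T', hT', i, hi, y, hy, -, hyT⟩ :=
      hF.exists_isModification_not_rel (S := {a}) (D := ∅) (Finset.singleton_nonempty a) (by simp)
        hT (by simpa using ha)
    obtain rfl := Finset.mem_singleton.mp hi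
    exact ⟨_, hT'.toIsIndepTransversal.update hy fun j hj _ ↦ hyT j hj⟩

end IndependentTransversals

section Relations

variable {α β : Type*} (H : SetRel α β)

theorem relImage_insert (a : α) (V : Set α) : H.image (insert a V) = H.image {a} ∪ H.image V := by
  rw [Set.insert_eq, SetRel.image_union]

theorem mem_relImage_iff {V : Set α} {b : β} :
    b ∈ H.image V ↔ ¬ Disjoint (H.preimage {b}) V := by
  simp [Set.not_disjoint_iff, and_comm]

theorem ncard_inv : H.inv.ncard = H.ncard := by
  rw [SetRel.inv, ← Set.image_swap_eq_preimage_swap,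
    Set.ncard_image_of_injective _ Prod.swap_injective]

theorem ncard_eq_sum_ncard_relImage [Fintype α] [Finite β] :
    H.ncard = ∑ a, (H.image {a}).ncard := by
  have e : (Σ a, H.image {a}) ≃ H :=
    { toFun x := ⟨(x.1, x.2), by simpa [SetRel.image] using x.2.2⟩
      invFun x := ⟨x.1.1, x.1.2, by simp [SetRel.image]⟩ }
  simp only [← Nat.card_coe_set_eq, ← Nat.card_sigma, Nat.card_congr e]

theorem ncard_eq_sum_ncard_relPreimage [Finite α] [Fintype β] :
    H.ncard = ∑ b, (H.preimage {b}).ncard :=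
  (ncard_inv H).symm.trans (ncard_eq_sum_ncard_relImage H.inv)

theorem ncard_mul_le_ncard_rel [Finite α] [Finite β] (d : ℕ) :
    {a | (H.image {a}).ncard = d}.ncard * d ≤ H.ncard := by
  classical
  have := Fintype.ofFinite α
  calc
    _ = ∑ a with (H.image {a}).ncard = d, (H.image {a}).ncard := by
      rw [Set.ncard_eq_toFinset_card',
        Finset.sum_congr rfl fun a ha ↦ (Finset.mem_filter.mp ha).2]
      simp
    _ ≤ ∑ a, (H.image {a}).ncard := Finset.sum_le_sum_of_subset (Finset.subset_univ _)
    _ = H.ncard := (ncard_eq_sum_ncard_relImage H).symm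

end Relations

section Expectations

theorem mul_div_two_le_one_sub_pow {p : ℝ} (hp₀ : 0 ≤ p) (hp₁ : p ≤ 1) {k : ℕ} (hk : p * k ≤ 1) :
    p * k / 2 ≤ 1 - (1 - p) ^ k := by
  have hmul : (1 - p) ^ k * (1 + p * k) ≤ 1 := calc
    (1 - p) ^ k * (1 + p * k) ≤ (1 - p) ^ k * (1 + p) ^ k := by
      gcongr
      · simpa [mul_comm] using one_add_mul_le_pow (by linarith : -2 ≤ p) k
    _ = (1 - p ^ 2) ^ k := by rw [← mul_pow]; ring
    _ ≤ 1 := pow_le_one₀ (by nlinarith) (by nlinarith)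
  have hpk : 0 ≤ p * k := by positivity
  refine le_of_mul_le_mul_right ?_ (by positivity : 0 < 1 + p * k)
  nlinarith

theorem integral_ncard {Ω W : Type*} [Fintype W] [Finite Ω] [MeasurableSpace Ω]
    [MeasurableSingletonClass Ω] (μ : Measure Ω) [IsFiniteMeasure μ] (g : Ω → Set W) :
    ∫ ω, ((g ω).ncard : ℝ) ∂μ = ∑ v, μ.real {ω | v ∈ g ω} := by
  classical
  have hg : ∀ ω, ((g ω).ncard : ℝ) = ∑ v, {ω | v ∈ g ω}.indicator 1 ω := fun ω ↦ by
    simp [Set.ncard_eq_toFinset_card', Set.indicator_apply]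
  simp only [hg]
  rw [integral_finsetSum _ fun _ _ ↦ .of_finite]
  simp only [integral_indicator_one (Set.toFinite _).measurableSet]

end Expectations

section BoundedBoundary

variable {W : Type*} [Finite W] {G : SimpleGraph W} {R Z : Set W} {d : ℕ} {H : SetRel W W}

/-- A set of edges of `G`, directed from `R` to the outside of `R ∪ Z`, in which every vertex has
at most `d` out-neighbours and at most `d` in-neighbours. -/
structure IsBoundedBoundary (G : SimpleGraph W) (R Z : Set W) (d : ℕ) (H : SetRel W W) :
    Prop where
  subset : ∀ ⦃u v⦄, (u, v) ∈ H → u ∈ R ∧ v ∉ R ∧ v ∉ Z ∧ G.Adj u v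
  ncard_image_le : ∀ u, (H.image {u}).ncard ≤ d
  ncard_preimage_le : ∀ v, (H.preimage {v}).ncard ≤ d

theorem IsBoundedBoundary.insert {u v : W} (hH : IsBoundedBoundary G R Z d H) (hu : u ∈ R)
    (hvR : v ∉ R) (hvZ : v ∉ Z) (huv : G.Adj u v) (hud : (H.image {u}).ncard < d)
    (hvd : (H.preimage {v}).ncard < d) : IsBoundedBoundary G R Z d (insert (u, v) H) where
  subset u' v' h := by
    obtain h | h := h
    · cases h
      exact ⟨hu, hvR, hvZ, huv⟩
    · exact hH.subset h
  ncard_image_le u' := by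
    obtain rfl | hne := eq_or_ne u' u
    · refine (Set.ncard_le_ncard (t := Insert.insert v (H.image {u'})) ?_).trans
        ((Set.ncard_insert_le _ _).trans hud)
      grind [SetRel.image]
    · refine (Set.ncard_le_ncard ?_).trans (hH.ncard_image_le u')
      grind [SetRel.image]
  ncard_preimage_le v' := by
    obtain rfl | hne := eq_or_ne v' v
    · refine (Set.ncard_le_ncard (t := Insert.insert u (H.preimage {v'})) ?_).trans
        ((Set.ncard_insert_le _ _).trans hvd)
      grind [SetRel.preimage]
    · refine (Set.ncard_le_ncard ?_).trans (hH.ncard_preimage_le v')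
      grind [SetRel.preimage]

theorem exists_isBoundedBoundary_outerNeighbors_subset (G : SimpleGraph W) (R Z : Set W)
    (d : ℕ) :
    ∃ H, IsBoundedBoundary G R Z d H ∧
      outerNeighbors (G.deleteEdges ((fun e ↦ s(e.1, e.2)) '' H))
          (R \ {u | (H.image {u}).ncard = d}) ⊆
        {u | (H.image {u}).ncard = d} ∪ {v | (H.preimage {v}).ncard = d} ∪ Z := by
  obtain ⟨H, hH, hmax⟩ := (Set.toFinite {H | IsBoundedBoundary G R Z d H}).exists_maximal
    ⟨∅, by simp, by simp, by simp⟩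
  refine ⟨H, hH, ?_⟩
  rintro v ⟨hvU, u, ⟨huR, hud⟩, huv⟩
  rw [SimpleGraph.deleteEdges_adj] at huv
  by_contra! hv
  simp only [Set.mem_union, not_or] at hv
  have hvR : v ∉ R := fun h ↦ hvU ⟨h, hv.1.1⟩
  have hins := hH.insert huR hvR hv.2 huv.1 ((hH.ncard_image_le u).lt_of_ne hud)
    ((hH.ncard_preimage_le v).lt_of_ne hv.1.2)
  exact huv.2 ⟨_, hmax hins (Set.subset_insert _ _) (Set.mem_insert _ _), rfl⟩

theorem IsBoundedBoundary.le_integral_ncard_image (hH : IsBoundedBoundary G R Z d H)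
    {p : I} (hpd : (p : ℝ) * d ≤ 1) :
    (p : ℝ) * H.ncard / 2 ≤ ∫ V, ((H.image V).ncard : ℝ) ∂setBer(Set.univ, p) := by
  have := Fintype.ofFinite W
  rw [integral_ncard, ncard_eq_sum_ncard_relPreimage H, Nat.cast_sum, Finset.mul_sum,
    Finset.sum_div]
  refine Finset.sum_le_sum fun v _ ↦ ?_
  simp only [mem_relImage_iff]
  rw [← Set.compl_ofPred, probReal_compl_eq_one_sub (Set.toFinite _).measurableSet,
    setBernoulli_real_disjoint, Set.inter_univ]
  have hdeg : (p : ℝ) * (H.preimage {v}).ncard ≤ p * d := by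
    gcongr
    · exact p.2.1
    · exact hH.ncard_preimage_le v
  exact mul_div_two_le_one_sub_pow p.2.1 p.2.2 (hdeg.trans hpd)

theorem IsBoundedBoundary.abs_ncard_image_insert_sub_le [DecidablePred (· ∈ R)]
    (hH : IsBoundedBoundary G R Z d H) (a : W) (V : Set W) :
    |((H.image (Insert.insert a V)).ncard : ℝ) - (H.image V).ncard| ≤
      (if a ∈ R then (d : NNReal) else 0 : NNReal) := by
  have hle : (H.image V).ncard ≤ (H.image (Insert.insert a V)).ncard :=
    Set.ncard_le_ncard (SetRel.image_mono (Set.subset_insert a V))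
  rw [abs_of_nonneg (by simpa using hle), relImage_insert, sub_le_iff_le_add]
  split_ifs with ha
  · rw [NNReal.coe_natCast]
    exact_mod_cast (Set.ncard_union_le _ _).trans (Nat.add_le_add_right (hH.ncard_image_le a) _)
  · have hempty : H.image {a} = ∅ := Set.eq_empty_of_forall_notMem fun v ⟨u, hu, huv⟩ ↦
      ha ((Set.mem_singleton_iff.mp hu) ▸ (hH.subset huv).1)
    simp [hempty]

theorem IsBoundedBoundary.setBernoulli_real_ncard_image_lt_le (hH : IsBoundedBoundary G R Z d H)
    {p : I} (hpd : (p : ℝ) * d ≤ 1) (hpd' : 1 ≤ 2 * ((p : ℝ) * d)) (hR : R.Nonempty) {α : ℝ}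
    (hα : 0 ≤ α) (hHcard : α * d * R.ncard / 4 ≤ H.ncard) :
    setBer(Set.univ, p).real {V | ((H.image V).ncard : ℝ) < α * R.ncard / 32} ≤
      Real.exp (-(α ^ 2 * p ^ 2 * R.ncard / 512)) := by
  classical
  have := Fintype.ofFinite W
  have hmean : α * R.ncard / 16 ≤ ∫ V, ((H.image V).ncard : ℝ) ∂setBer(Set.univ, p) := by
    refine le_trans ?_ (hH.le_integral_ncard_image hpd)
    have hαR : 0 ≤ α * R.ncard := by positivity
    nlinarith [p.2.1]
  have htail := setBernoulli_real_le_integral_sub_le Finset.univ p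
    (c := fun a ↦ if a ∈ R then (d : NNReal) else 0) (f := fun V ↦ ((H.image V).ncard : ℝ))
    hH.abs_ncard_image_insert_sub_le (s := α * R.ncard / 32)
    (by positivity)
  have hsum : ∑ a, (if a ∈ R then (d : NNReal) else 0) ^ 2 = d ^ 2 * R.ncard := by
    simp [ite_pow, ← Finset.sum_filter, Set.ncard_eq_toFinset_card', mul_comm]
  rw [Finset.coe_univ, hsum] at htail
  push_cast at htail
  refine (measureReal_mono fun V hV ↦ ?_).trans (htail.trans (Real.exp_le_exp.mpr ?_))
  · rw [Set.mem_ofPred_eq] at hV ⊢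
    linarith
  have hR₀ : (0 : ℝ) < R.ncard := by exact_mod_cast hR.ncard_pos
  have hd₀ : (0 : ℝ) < d := by
    by_contra! h
    nlinarith [p.2.1]
  have hpd_sq : ((p : ℝ) * d) ^ 2 ≤ 1 := pow_le_one₀ (by linarith) hpd
  calc -2 * (α * R.ncard / 32) ^ 2 / (d ^ 2 * R.ncard)
      = -(α ^ 2 * R.ncard / 512 * (1 / d ^ 2)) := by field_simp; ring
    _ ≤ -(α ^ 2 * R.ncard / 512 * p ^ 2) := by
        gcongr
        rwa [le_div_iff₀ (by positivity), ← mul_pow]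
    _ = -(α ^ 2 * p ^ 2 * R.ncard / 512) := by ring

end BoundedBoundary

section RobustExpanders

variable {W : Type*} [Fintype W] {G : SimpleGraph W} {α α' s : ℝ} {R Z : Set W} {d : ℕ}
  {H : SetRel W W}

/-- Every `U` with at most two thirds of the vertices keeps at least `α |U|` outer neighbours after
the deletion of any `s |U|` edges. An `(ε, c, s)`-expander is the case `α = ε / (log n) ^ c`. -/
def IsRobustExpander (G : SimpleGraph W) (α s : ℝ) : Prop :=
  ∀ (U : Set W) (F : Set (Sym2 W)), F ⊆ G.edgeSet → 1 ≤ U.ncard →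
    (U.ncard : ℝ) ≤ 2 / 3 * Fintype.card W → (F.ncard : ℝ) ≤ s * U.ncard →
    α * U.ncard ≤ (outerNeighbors (G.deleteEdges F) U).ncard

theorem IsRobustExpander.mono (hG : IsRobustExpander G α' s) (hα : α ≤ α') :
    IsRobustExpander G α s :=
  fun U F hF h₁ h₂ h₃ ↦ (by gcongr : α * U.ncard ≤ α' * U.ncard).trans (hG U F hF h₁ h₂ h₃)

theorem IsRobustExpander.exists_isBoundedBoundary (hG : IsRobustExpander G α s)
    (hα₀ : 0 ≤ α) (hα₁ : α ≤ 1) (hd : 1 ≤ d) (hds : d ≤ s) (hR : R.Nonempty)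
    (hRn : (R.ncard : ℝ) ≤ 2 / 3 * Fintype.card W) (hZ : Z.ncard ≤ α * R.ncard / 4) :
    ∃ H, IsBoundedBoundary G R Z d H ∧ α * d * R.ncard / 4 ≤ H.ncard := by
  obtain ⟨H, hH, hN⟩ := exists_isBoundedBoundary_outerNeighbors_subset G R Z d
  refine ⟨H, hH, ?_⟩
  by_contra! hlt
  set C := {u | (H.image {u}).ncard = d}
  set X := {v | (H.preimage {v}).ncard = d}
  set F : Set (Sym2 W) := (fun e : W × W ↦ s(e.1, e.2)) '' H
  have hd₀ : (0 : ℝ) < d := by exact_mod_cast hd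
  have hR₀ : (0 : ℝ) < R.ncard := by exact_mod_cast hR.ncard_pos
  have hC : C.ncard < α * R.ncard / 4 := by
    have h : (C.ncard * d : ℝ) ≤ H.ncard := mod_cast ncard_mul_le_ncard_rel H d
    refine lt_of_mul_lt_mul_right (h.trans_lt (hlt.trans_eq ?_)) hd₀.le
    ring
  have hX : X.ncard < α * R.ncard / 4 := by
    have h : (X.ncard * d : ℝ) ≤ H.ncard :=
      mod_cast (ncard_mul_le_ncard_rel H.inv d).trans_eq (ncard_inv H)
    refine lt_of_mul_lt_mul_right (h.trans_lt (hlt.trans_eq ?_)) hd₀.le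
    ring
  have hU : 3 / 4 * (R.ncard : ℝ) ≤ (R \ C).ncard := by
    have h : (R.ncard : ℝ) ≤ (R \ C).ncard + C.ncard :=
      mod_cast tsub_le_iff_right.mp (Set.le_ncard_sdiff C R)
    nlinarith
  have hF : (F.ncard : ℝ) ≤ s * (R \ C).ncard := by
    have h : (F.ncard : ℝ) ≤ H.ncard := mod_cast Set.ncard_image_le
    calc (F.ncard : ℝ) ≤ d * (α * R.ncard / 4) := by linarith
      _ ≤ d * (3 / 4 * R.ncard) := by gcongr; nlinarith
      _ ≤ s * (R \ C).ncard := by gcongr; exact hd₀.le.trans hds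
  have hexp := hG (R \ C) F
    (by rintro _ ⟨e, he, rfl⟩; exact (hH.subset he).2.2.2)
    (Nat.cast_pos (α := ℝ).mp (by linarith))
    (le_trans (by exact_mod_cast Set.ncard_le_ncard Set.sdiff_subset) hRn) hF
  have hcard : ((outerNeighbors (G.deleteEdges F) (R \ C)).ncard : ℝ) ≤
      C.ncard + X.ncard + Z.ncard := by
    exact_mod_cast (Set.ncard_le_ncard hN).trans ((Set.ncard_union_le _ _).trans
      (Nat.add_le_add_right (Set.ncard_union_le _ _) _))
  nlinarith

theorem IsExpander.isRobustExpander {ε c : ℝ} (hG : IsExpander G ε c s) :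
    IsRobustExpander G (ε / Real.logb 2 (Fintype.card W) ^ c) s :=
  hG

/-- The vertices outside `Z` that are adjacent to at least one vertex of `U`. -/
def neighborsAvoiding (G : SimpleGraph W) (Z U : Set W) : Set W :=
  {v | v ∉ Z ∧ ∃ u ∈ U, G.Adj u v}

theorem exists_nat_half_le_mul_le_one {p : I} (hp : 0 < (p : ℝ)) :
    ∃ d : ℕ, 1 ≤ d ∧ d ≤ 1 / (p : ℝ) ∧ 1 ≤ 2 * ((p : ℝ) * d) := by
  have h1 : 1 ≤ 1 / (p : ℝ) := (one_le_div hp).mpr p.2.2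
  have hd : 1 ≤ ⌊1 / (p : ℝ)⌋₊ := Nat.one_le_floor_iff _ |>.mpr h1
  have hd' : (1 : ℝ) ≤ ⌊1 / (p : ℝ)⌋₊ := by exact_mod_cast hd
  refine ⟨⌊1 / (p : ℝ)⌋₊, hd, Nat.floor_le (by positivity), ?_⟩
  have hlt := (div_lt_iff₀ hp).mp (Nat.lt_floor_add_one (1 / (p : ℝ)))
  nlinarith

theorem IsRobustExpander.setBernoulli_real_ncard_neighborsAvoiding_lt_le
    (hG : IsRobustExpander G α s) (hα₀ : 0 ≤ α) (hα₁ : α ≤ 1) {p : I} (hp : 0 < (p : ℝ))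
    (hps : 1 / (p : ℝ) ≤ s) (hR : R.Nonempty) (hRn : (R.ncard : ℝ) ≤ 2 / 3 * Fintype.card W)
    (hZ : Z.ncard ≤ α * R.ncard / 4) :
    setBer(Set.univ, p).real
        {V | ((neighborsAvoiding G (R ∪ Z) (R ∩ V)).ncard : ℝ) < α * R.ncard / 32} ≤
      Real.exp (-(α ^ 2 * p ^ 2 * R.ncard / 512)) := by
  obtain ⟨d, hd, hdp, hpd⟩ := exists_nat_half_le_mul_le_one hp
  obtain ⟨H, hH, hHcard⟩ := hG.exists_isBoundedBoundary hα₀ hα₁ hd (hdp.trans hps) hR hRn hZ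
  have hdp' : (p : ℝ) * d ≤ 1 := by rwa [mul_comm, ← le_div_iff₀ hp]
  refine (measureReal_mono fun V hV ↦ ?_).trans
    (hH.setBernoulli_real_ncard_image_lt_le hdp' hpd hR hα₀ hHcard)
  have hsub : H.image V ⊆ neighborsAvoiding G (R ∪ Z) (R ∩ V) := fun v ⟨u, huV, huv⟩ ↦
    have h := hH.subset huv
    ⟨not_or.mpr ⟨h.2.1, h.2.2.1⟩, u, ⟨h.1, huV⟩, h.2.2.2⟩
  rw [Set.mem_ofPred_eq] at hV ⊢
  exact (Nat.cast_le.mpr (Set.ncard_le_ncard hsub)).trans_lt hV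

end RobustExpanders

section Reach

variable {W : Type*} {G : SimpleGraph W} {A B Z X Y : Set W} {k : ℕ} {v : W}

/-- The vertices outside `Z` that are the end of a walk of length between `1` and `k + 1` which
starts in `X` and has all its internal vertices in `A \ Z`. -/
def reach (G : SimpleGraph W) (A Z X : Set W) : ℕ → Set W
  | 0 => neighborsAvoiding G Z X
  | k + 1 => reach G A Z X k ∪ neighborsAvoiding G Z (reach G A Z X k ∩ A)

theorem neighborsAvoiding_mono (h : X ⊆ Y) : neighborsAvoiding G Z X ⊆ neighborsAvoiding G Z Y :=
  fun _ hv ↦ hv.imp_right fun ⟨u, hu, huv⟩ ↦ ⟨u, h hu, huv⟩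

theorem neighborsAvoiding_union :
    neighborsAvoiding G Z (X ∪ Y) = neighborsAvoiding G Z X ∪ neighborsAvoiding G Z Y := by
  ext v
  simp only [neighborsAvoiding, Set.mem_union, Set.mem_ofPred_eq]
  grind

theorem reach_subset_succ : reach G A Z X k ⊆ reach G A Z X (k + 1) :=
  Set.subset_union_left

theorem disjoint_reach : Disjoint (reach G A Z X k) Z := by
  rw [Set.disjoint_left]
  induction k with
  | zero => exact fun _ hv ↦ hv.1
  | succ k ih => exact fun v hv ↦ hv.elim (ih ·) And.left

theorem reach_mono (h : A ⊆ B) : reach G A Z X k ⊆ reach G B Z X k := by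
  induction k with
  | zero => exact subset_rfl
  | succ k ih =>
    exact Set.union_subset_union ih (neighborsAvoiding_mono (Set.inter_subset_inter ih h))

theorem reach_union (G : SimpleGraph W) (A Z X Y : Set W) (k : ℕ) :
    reach G A Z (X ∪ Y) k = reach G A Z X k ∪ reach G A Z Y k := by
  induction k with
  | zero => exact neighborsAvoiding_union
  | succ k ih =>
    simp only [reach, ih, Set.union_inter_distrib_right, neighborsAvoiding_union]
    exact Set.union_union_union_comm _ _ _ _

theorem reach_empty (A : Set W) (k : ℕ) : reach G A Z ∅ k = ∅ := by
  induction k with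
  | zero => simp [reach, neighborsAvoiding]
  | succ k ih => simp [reach, ih, neighborsAvoiding]

theorem exists_walk_of_mem_reach (hv : v ∈ reach G A Z X k) :
    ∃ x ∈ X, ∃ P : G.Walk x v, P.length ≤ k + 1 ∧
      ∀ w ∈ P.support, w = x ∨ w = v ∨ w ∈ A \ Z := by
  induction k generalizing v with
  | zero =>
    obtain ⟨-, u, hu, huv⟩ := hv
    exact ⟨u, hu, huv.toWalk, by simp, fun w hw ↦ by simp at hw; tauto⟩
  | succ k ih =>
    obtain hv | ⟨-, u, ⟨hu, huA⟩, huv⟩ := hv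
    · obtain ⟨x, hx, P, hP, hsupp⟩ := ih hv
      exact ⟨x, hx, P, by omega, hsupp⟩
    · obtain ⟨x, hx, P, hP, hsupp⟩ := ih hu
      refine ⟨x, hx, P.concat huv, by simpa using hP, fun w hw ↦ ?_⟩
      rw [SimpleGraph.Walk.support_concat, List.mem_append, List.mem_singleton] at hw
      have huZ : u ∉ Z := Set.disjoint_left.mp disjoint_reach hu
      grind

theorem exists_path_of_mem_reach {x y u : W} (hx : u ∈ reach G A Z {x} k)
    (hy : u ∈ reach G A Z {y} k) (hu : u ∈ A) :
    ∃ P : G.Walk x y, P.IsPath ∧ P.length ≤ 2 * (k + 1) ∧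
      ∀ w ∈ P.support, w = x ∨ w = y ∨ w ∈ A \ Z := by
  classical
  have huZ : u ∉ Z := Set.disjoint_left.mp disjoint_reach hx
  obtain ⟨_, rfl, P, hP, hPsupp⟩ := exists_walk_of_mem_reach hx
  obtain ⟨_, rfl, Q, hQ, hQsupp⟩ := exists_walk_of_mem_reach hy
  refine ⟨(P.append Q.reverse).bypass, SimpleGraph.Walk.bypass_isPath _, ?_, fun w hw ↦ ?_⟩
  · refine (SimpleGraph.Walk.length_bypass_le_length _).trans ?_
    rw [SimpleGraph.Walk.length_append, SimpleGraph.Walk.length_reverse]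
    omega
  · have hw' := SimpleGraph.Walk.support_bypass_subset_support _ hw
    rw [SimpleGraph.Walk.mem_support_append_iff, SimpleGraph.Walk.support_reverse,
      List.mem_reverse] at hw'
    grind

theorem reach_union_neighborsAvoiding_subset (A V : Set W) :
    reach G A Z X k ∪ neighborsAvoiding G (reach G A Z X k ∪ Z) (reach G A Z X k ∩ V) ⊆
      reach G (A ∪ V) Z X (k + 1) := by
  have hmono : reach G A Z X k ⊆ reach G (A ∪ V) Z X k := reach_mono Set.subset_union_left
  refine Set.union_subset_union hmono fun v ⟨hv, u, hu, huv⟩ ↦ ?_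
  exact ⟨fun h ↦ hv (.inr h), u, ⟨hmono hu.1, .inr hu.2⟩, huv⟩

end Reach

section HitFailure

variable {W : Type*} {G : SimpleGraph W} {D y : ℝ} {p : I}

theorem exp_neg_mul_le_pow {γ D y r : ℝ} {m : ℕ} (hγ : 0 ≤ γ) (hy : Real.exp (-(γ * D)) ≤ y)
    (hr : D * m ≤ r) : Real.exp (-(γ * r)) ≤ y ^ m :=
  calc
    Real.exp (-(γ * r)) ≤ Real.exp (-(γ * D)) ^ m := by
      rw [← Real.exp_nat_mul, Real.exp_le_exp]
      nlinarith
    _ ≤ y ^ m := pow_le_pow_left₀ (Real.exp_pos _).le hy m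

/-- The event that a large intersection of the sets reached from `X` and from `Y` is missed,
indexed by the triple `X, Y, Z` as a family over `Fin 3` to match the union bound. -/
def hitFailure (G : SimpleGraph W) (D : ℝ) (k : ℕ) (A : Set W) (X : Fin 3 → Set W) :
    Set (Set W) :=
  {V | D * ((X 0).ncard + (X 1).ncard + (X 2).ncard + 1) ≤
      (reach G A (X 2) (X 0) k ∩ reach G A (X 2) (X 1) k).ncard ∧
    Disjoint (reach G A (X 2) (X 0) k ∩ reach G A (X 2) (X 1) k) V}

theorem setBernoulli_real_disjoint_le_exp [Finite W] (N : Set W) (p : I) :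
    setBer(Set.univ, p).real {V | Disjoint N V} ≤ Real.exp (-(p * N.ncard)) := by
  rw [setBernoulli_real_disjoint, Set.inter_univ, mul_comm, neg_mul_eq_mul_neg, Real.exp_nat_mul]
  exact pow_le_pow_left₀ (by linarith [p.2.2]) (Real.one_sub_le_exp_neg p) _

theorem setBernoulli_real_hitFailure_le [Finite W] (hy : Real.exp (-(p * D)) ≤ y) (k : ℕ)
    (A : Set W) (X : Fin 3 → Set W) :
    setBer(Set.univ, p).real (hitFailure G D k A X) ≤ y ^ (1 + ∑ i, (X i).ncard) := by
  have hy₀ : 0 ≤ y := (Real.exp_pos _).le.trans hy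
  set N := reach G A (X 2) (X 0) k ∩ reach G A (X 2) (X 1) k
  by_cases h : D * ((X 0).ncard + (X 1).ncard + (X 2).ncard + 1) ≤ N.ncard
  · calc
      _ ≤ setBer(Set.univ, p).real {V | Disjoint N V} := measureReal_mono fun V hV ↦ hV.2
      _ ≤ Real.exp (-(p * N.ncard)) := setBernoulli_real_disjoint_le_exp N p
      _ ≤ y ^ (1 + ∑ i, (X i).ncard) := by
        refine exp_neg_mul_le_pow p.2.1 hy (h.trans' (le_of_eq ?_))
        push_cast [Fin.sum_univ_three]
        ring
  · have hempty : hitFailure G D k A X = ∅ :=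
      Set.eq_empty_of_forall_notMem fun V hV ↦ h hV.1
    rw [hempty, measureReal_empty]
    positivity

end HitFailure

section GoodSteps

variable {W : Type*} [Fintype W] {G : SimpleGraph W} {D α β s y : ℝ} {p : I}

/-- Passing from `A` to `B` as the set of allowed internal vertices makes every reached set that
is large in terms of `X` and `Z`, but not larger than two thirds of the graph, grow by a factor
`β`; and `B` meets every large intersection of two reached sets. -/
structure IsGoodStep (G : SimpleGraph W) (D β : ℝ) (k : ℕ) (A B : Set W) : Prop where
  grow : ∀ X Z, D * (X.ncard + Z.ncard + 1) ≤ (reach G A Z X k).ncard →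
    ((reach G A Z X k).ncard : ℝ) ≤ 2 / 3 * Fintype.card W →
      β * (reach G A Z X k).ncard ≤ (reach G B Z X (k + 1)).ncard
  hit : ∀ X Y Z, D * (X.ncard + Y.ncard + Z.ncard + 1) ≤
    (reach G A Z X k ∩ reach G A Z Y k).ncard →
      ¬ Disjoint (reach G A Z X k ∩ reach G A Z Y k) B

/-- The event that the set reached from `X` fails to grow, indexed by the pair `X, Z` as a family
over `Fin 2` to match the union bound. -/
def growFailure (G : SimpleGraph W) (D α : ℝ) (k : ℕ) (A : Set W) (X : Fin 2 → Set W) :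
    Set (Set W) :=
  {V | D * ((X 0).ncard + (X 1).ncard + 1) ≤ (reach G A (X 1) (X 0) k).ncard ∧
    ((reach G A (X 1) (X 0) k).ncard : ℝ) ≤ 2 / 3 * Fintype.card W ∧
    ((reach G (A ∪ V) (X 1) (X 0) (k + 1)).ncard : ℝ) <
      (1 + α / 32) * (reach G A (X 1) (X 0) k).ncard}

theorem IsRobustExpander.setBernoulli_real_growFailure_le (hG : IsRobustExpander G α s)
    (hα₀ : 0 < α) (hα₁ : α ≤ 1) (hp : 0 < (p : ℝ)) (hps : 1 / (p : ℝ) ≤ s) (hD : 4 ≤ α * D)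
    (hy : Real.exp (-(α ^ 2 * p ^ 2 / 512 * D)) ≤ y) (k : ℕ) (A : Set W) (X : Fin 2 → Set W) :
    setBer(Set.univ, p).real (growFailure G D α k A X) ≤ y ^ (1 + ∑ i, (X i).ncard) := by
  have hy₀ : 0 ≤ y := (Real.exp_pos _).le.trans hy
  by_cases h : D * ((X 0).ncard + (X 1).ncard + 1) ≤ (reach G A (X 1) (X 0) k).ncard ∧
    ((reach G A (X 1) (X 0) k).ncard : ℝ) ≤ 2 / 3 * Fintype.card W
  swap
  · have hempty : growFailure G D α k A X = ∅ :=
      Set.eq_empty_of_forall_notMem fun V hV ↦ h ⟨hV.1, hV.2.1⟩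
    rw [hempty, measureReal_empty]
    positivity
  set R := reach G A (X 1) (X 0) k with hR
  have hD₀ : 0 < D := by by_contra! hD'; nlinarith
  have hR₀ : R.Nonempty := by
    rw [← Set.ncard_pos, ← Nat.cast_pos (α := ℝ)]
    exact lt_of_lt_of_le (by positivity) h.1
  have hZ : ((X 1).ncard : ℝ) ≤ α * R.ncard / 4 := by
    nlinarith [h.1, (X 0).ncard.cast_nonneg (α := ℝ), (X 1).ncard.cast_nonneg (α := ℝ)]
  calc
    _ ≤ setBer(Set.univ, p).real
        {V | ((neighborsAvoiding G (R ∪ X 1) (R ∩ V)).ncard : ℝ) < α * R.ncard / 32} := by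
      refine measureReal_mono fun V hV ↦ ?_
      have hdisj : Disjoint R (neighborsAvoiding G (R ∪ X 1) (R ∩ V)) :=
        Set.disjoint_left.mpr fun v hv hv' ↦ hv'.1 (.inl hv)
      have hle := Set.ncard_le_ncard (reach_union_neighborsAvoiding_subset (G := G)
        (Z := X 1) (X := X 0) (k := k) A V)
      rw [← hR, Set.ncard_union_eq hdisj, ← Nat.cast_le (α := ℝ), Nat.cast_add] at hle
      rw [Set.mem_ofPred_eq]
      linarith [hV.2.2]
    _ ≤ Real.exp (-(α ^ 2 * p ^ 2 / 512 * R.ncard)) := by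
      refine (hG.setBernoulli_real_ncard_neighborsAvoiding_lt_le hα₀.le hα₁ hp hps hR₀ h.2
        hZ).trans_eq ?_
      ring_nf
    _ ≤ y ^ (1 + ∑ i, (X i).ncard) := by
      refine exp_neg_mul_le_pow (by positivity) hy (h.1.trans' (le_of_eq ?_))
      push_cast [Fin.sum_univ_two]
      ring

theorem setOf_not_isGoodStep_subset (k : ℕ) (A : Set W) :
    {V | ¬ IsGoodStep G D (1 + α / 32) k A (A ∪ V)} ⊆
      (⋃ X, growFailure G D α k A X) ∪ ⋃ X, hitFailure G D k A X := by
  intro V hV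
  by_contra! hcon
  simp only [Set.mem_union, Set.mem_iUnion, not_or, not_exists] at hcon
  refine hV ⟨fun X Z hX hXn ↦ ?_, fun X Y Z hXY hdisj ↦ ?_⟩
  · by_contra! hlt
    exact hcon.1 ![X, Z] ⟨hX, hXn, hlt⟩
  · exact hcon.2 ![X, Y, Z] ⟨hXY, hdisj.mono_right Set.subset_union_right⟩

theorem mul_exp_le_two_mul {x : ℝ} (hy : 0 ≤ y) (hx : x ≤ 1 / 2) : y * Real.exp x ≤ 2 * y := by
  have hexp : Real.exp x ≤ 2 := by
    refine (Real.exp_le_exp.mpr (hx.trans ?_)).trans_eq (Real.exp_log two_pos)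
    linarith [Real.log_two_gt_d9]
  nlinarith

theorem IsRobustExpander.setBernoulli_real_not_isGoodStep_le (hG : IsRobustExpander G α s)
    (hα₀ : 0 < α) (hα₁ : α ≤ 1) (hp : 0 < (p : ℝ)) (hps : 1 / (p : ℝ) ≤ s) (hD : 4 ≤ α * D)
    (hy : Real.exp (-(α ^ 2 * p ^ 2 / 512 * D)) ≤ y) (hny : 3 * Fintype.card W * y ≤ 1 / 2)
    (k : ℕ) (A : Set W) :
    setBer(Set.univ, p).real {V | ¬ IsGoodStep G D (1 + α / 32) k A (A ∪ V)} ≤ 4 * y := by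
  have hy₀ : 0 ≤ y := (Real.exp_pos _).le.trans hy
  have hyhit : Real.exp (-(p * D)) ≤ y := by
    refine (Real.exp_le_exp.mpr (neg_le_neg ?_)).trans hy
    have hD₀ : 0 ≤ D := by by_contra! hD'; nlinarith
    have hαp : α ^ 2 * (p : ℝ) ^ 2 ≤ 1 * p :=
      mul_le_mul (pow_le_one₀ hα₀.le hα₁) (pow_le_of_le_one hp.le p.2.2 two_ne_zero)
        (by positivity) zero_le_one
    gcongr
    linarith
  have hgrow : setBer(Set.univ, p).real (⋃ X, growFailure G D α k A X) ≤ 2 * y := by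
    refine (measureReal_iUnion_le_mul_exp _ hy₀
      (hG.setBernoulli_real_growFailure_le hα₀ hα₁ hp hps hD hy k A)).trans
      (mul_exp_le_two_mul hy₀ ?_)
    norm_num
    linarith
  have hhit : setBer(Set.univ, p).real (⋃ X, hitFailure G D k A X) ≤ 2 * y := by
    refine (measureReal_iUnion_le_mul_exp _ hy₀
      (setBernoulli_real_hitFailure_le hyhit k A)).trans (mul_exp_le_two_mul hy₀ ?_)
    norm_num
    linarith
  refine (measureReal_mono (setOf_not_isGoodStep_subset k A)).trans
    ((measureReal_union_le _ _).trans ?_)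
  linarith

end GoodSteps

section GoodChains

variable {W : Type*} [Fintype W] {G : SimpleGraph W} {D β δ : ℝ} {M : ℕ}

/-- An increasing sequence of sets of allowed internal vertices whose first `M` steps are good. -/
def IsGoodChain (G : SimpleGraph W) (D β : ℝ) (M : ℕ) (f : ℕ → Set W) : Prop :=
  ∀ k < M, f k ⊆ f (k + 1) ∧ IsGoodStep G D β k (f k) (f (k + 1))

theorem IsGoodChain.exists_succ {f : ℕ → Set W} (hf : IsGoodChain G D β M f) {V : Set W}
    (hV : IsGoodStep G D β M (f M) (f M ∪ V)) :
    ∃ g, IsGoodChain G D β (M + 1) g ∧ g (M + 1) = f M ∪ V := by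
  refine ⟨fun k ↦ if k ≤ M then f k else f M ∪ V, fun k hk ↦ ?_, by simp⟩
  obtain hk | rfl := (Nat.lt_succ_iff.mp hk).lt_or_eq
  · simpa only [hk.le, Nat.succ_le_of_lt hk, if_true] using hf k hk
  · simpa using hV

theorem setBernoulli_real_not_exists_isGoodChain_le {p q : I} (hδ : 0 ≤ δ)
    (hstep : ∀ k A, setBer(Set.univ, p).real {V | ¬ IsGoodStep G D β k A (A ∪ V)} ≤ δ)
    (hq : σ q = σ p ^ M) :
    setBer(Set.univ, q).real {V | ¬ ∃ f, IsGoodChain G D β M f ∧ f M = V} ≤ M * δ := by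
  induction M generalizing q with
  | zero =>
    have hempty : {V | ¬ ∃ f, IsGoodChain G D β 0 f ∧ f 0 = V} = ∅ :=
      Set.eq_empty_of_forall_notMem fun V hV ↦ hV ⟨fun _ ↦ V, by simp [IsGoodChain], rfl⟩
    rw [hempty, measureReal_empty, Nat.cast_zero, zero_mul]
  | succ M ih =>
    refine (setBernoulli_real_le_add_of_union (a := σ (σ p ^ M)) (b := p)
      (by rw [hq, pow_succ, unitInterval.symm_symm]) hδ
      (ih (unitInterval.symm_symm _)) fun A hA ↦ ?_).trans_eq ?_
    · obtain ⟨f, hf, rfl⟩ := not_not.mp hA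
      refine (measureReal_mono fun V hV ↦ ?_).trans (hstep M (f M))
      exact fun hgood ↦ hV (hf.exists_succ hgood)
    · push_cast
      ring

end GoodChains

theorem exists_union_eq_ncard_le {W : Type*} [Finite W] {X : Set W} {m : ℕ} (hX : X.ncard ≤ 2 * m) :
    ∃ Y Y' : Set W, Y ∪ Y' = X ∧ Y.ncard ≤ m ∧ Y'.ncard ≤ m := by
  obtain ⟨Y, hYX, hY⟩ := Set.exists_subset_card_eq (min_le_right m X.ncard)
  refine ⟨Y, X \ Y, Set.union_sdiff_cancel hYX, hY.trans_le (min_le_left _ _), ?_⟩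
  rw [Set.ncard_sdiff hYX]
  omega

section Growth

variable {W : Type*} [Fintype W] {G : SimpleGraph W} {D β : ℝ} {M i j l t : ℕ} {f : ℕ → Set W}
  {X Z : Set W}

/-- More than two thirds of the vertices; this is where robust expansion stops, and two such sets
have a large intersection. -/
def IsLarge (U : Set W) : Prop :=
  2 / 3 * (Fintype.card W : ℝ) < U.ncard

theorem ncard_le_card (U : Set W) : (U.ncard : ℝ) ≤ Fintype.card W := by
  rw [← Nat.card_eq_fintype_card]
  exact_mod_cast U.ncard_le_card

theorem IsLarge.card_div_three_lt_ncard_inter {U V : Set W} (hU : IsLarge U) (hV : IsLarge V) :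
    (Fintype.card W : ℝ) / 3 < (U ∩ V).ncard := by
  have h : ((U ∪ V).ncard : ℝ) + (U ∩ V).ncard = U.ncard + V.ncard := by
    exact_mod_cast Set.ncard_union_add_ncard_inter U V
  rw [IsLarge] at hU hV
  linarith [ncard_le_card (U ∪ V)]

theorem IsGoodChain.reach_subset (hf : IsGoodChain G D β M f) (hij : i ≤ j) (hj : j ≤ M) :
    reach G (f i) Z X i ⊆ reach G (f j) Z X j := by
  induction j, hij using Nat.le_induction with
  | base => exact subset_rfl
  | succ j _ ih =>
    exact (ih (by omega)).trans ((reach_mono (hf j (by omega)).1).trans reach_subset_succ)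

theorem IsGoodChain.ncard_reach_le (hf : IsGoodChain G D β M f) (hij : i ≤ j) (hj : j ≤ M) :
    ((reach G (f i) Z X i).ncard : ℝ) ≤ (reach G (f j) Z X j).ncard :=
  Nat.cast_le.mpr (Set.ncard_le_ncard (hf.reach_subset hij hj))

theorem IsGoodChain.isLarge_or_pow_mul_ncard_le (hf : IsGoodChain G D β M f) (hβ : 0 ≤ β)
    (hX : D * (X.ncard + Z.ncard + 1) ≤ (reach G (f i) Z X i).ncard) (hj : i + j ≤ M) :
    IsLarge (reach G (f (i + j)) Z X (i + j)) ∨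
      β ^ j * (reach G (f i) Z X i).ncard ≤ (reach G (f (i + j)) Z X (i + j)).ncard := by
  induction j with
  | zero => simp
  | succ j ih =>
    by_cases hlarge : IsLarge (reach G (f (i + j)) Z X (i + j))
    · exact .inl (hlarge.trans_le (hf.ncard_reach_le (by omega) hj))
    right
    calc
      _ = β * (β ^ j * (reach G (f i) Z X i).ncard) := by ring
      _ ≤ β * (reach G (f (i + j)) Z X (i + j)).ncard :=
        mul_le_mul_of_nonneg_left ((ih (by omega)).resolve_left hlarge) hβ
      _ ≤ (reach G (f (i + (j + 1))) Z X (i + (j + 1))).ncard :=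
        (hf (i + j) (by omega)).2.grow X Z
          (hX.trans (hf.ncard_reach_le (by omega) (by omega))) (not_lt.mp hlarge)

theorem IsGoodChain.isLarge_reach (hf : IsGoodChain G D β M f) (hβ : 0 ≤ β) (hD : 1 ≤ D)
    (hl : Fintype.card W ≤ β ^ l)
    (hX : D * (X.ncard + Z.ncard + 1) ≤ (reach G (f i) Z X i).ncard) (hi : i + l ≤ M) :
    IsLarge (reach G (f (i + l)) Z X (i + l)) := by
  obtain h | h := hf.isLarge_or_pow_mul_ncard_le hβ hX hi
  · exact h
  have h₁ : (1 : ℝ) ≤ (reach G (f i) Z X i).ncard := hX.trans' (by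
    nlinarith [X.ncard.cast_nonneg (α := ℝ), Z.ncard.cast_nonneg (α := ℝ)])
  have hn : (1 : ℝ) ≤ Fintype.card W := h₁.trans (ncard_le_card _)
  have hpow : β ^ l ≤ β ^ l * (reach G (f i) Z X i).ncard :=
    le_mul_of_one_le_right (by positivity) h₁
  rw [IsLarge]
  linarith

theorem IsGoodChain.exists_isLarge_reach_singleton (hf : IsGoodChain G D β M f) (hβ : 0 ≤ β)
    (hD : 1 ≤ D) (hl : Fintype.card W ≤ β ^ l) (hXt : X.ncard ≤ 2 ^ t)
    (hsmall : D * (X.ncard + Z.ncard + 1) ≤ Fintype.card W / 3)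
    (hX : IsLarge (reach G (f i) Z X i)) (hi : i + t * l ≤ M) :
    ∃ x ∈ X, IsLarge (reach G (f (i + t * l)) Z {x} (i + t * l)) := by
  induction t generalizing X i with
  | zero =>
    obtain rfl | ⟨x, rfl⟩ :=
      (Set.ncard_le_one_iff_subsingleton.mp hXt).eq_empty_or_singleton
    · rw [reach_empty, IsLarge, Set.ncard_empty] at hX
      exact absurd hX (not_lt.mpr (by rw [Nat.cast_zero]; positivity))
    · exact ⟨x, rfl, by simpa using hX⟩
  | succ t ih =>
    obtain ⟨Y, hYX, hYt, hY⟩ : ∃ Y ⊆ X, Y.ncard ≤ 2 ^ t ∧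
        (Fintype.card W : ℝ) / 3 ≤ (reach G (f i) Z Y i).ncard := by
      obtain ⟨Y, Y', rfl, hY, hY'⟩ := exists_union_eq_ncard_le (hXt.trans_eq (pow_succ' 2 t))
      have hle : ((reach G (f i) Z (Y ∪ Y') i).ncard : ℝ) ≤
          (reach G (f i) Z Y i).ncard + (reach G (f i) Z Y' i).ncard := by
        rw [reach_union]
        exact_mod_cast Set.ncard_union_le _ _
      rw [IsLarge] at hX
      by_cases h : (Fintype.card W : ℝ) / 3 ≤ (reach G (f i) Z Y i).ncard
      · exact ⟨Y, Set.subset_union_left, hY, h⟩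
      · exact ⟨Y', Set.subset_union_right, hY', by linarith⟩
    have hYsmall : D * (Y.ncard + Z.ncard + 1) ≤ Fintype.card W / 3 := by
      refine hsmall.trans' ?_
      have := Set.ncard_le_ncard hYX
      gcongr
    have heq : i + (t + 1) * l = i + l + t * l := by ring
    rw [heq] at hi ⊢
    have hlarge := hf.isLarge_reach hβ hD hl (hYsmall.trans hY) (by omega)
    obtain ⟨x, hx, hxl⟩ := ih hYt hYsmall hlarge hi
    exact ⟨x, hYX hx, hxl⟩

theorem IsGoodChain.exists_mem_isLarge_reach (hf : IsGoodChain G D β M f) (hβ : 0 ≤ β)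
    (hD : 1 ≤ D) (hl : Fintype.card W ≤ β ^ l) (ht : Fintype.card W ≤ 2 ^ t)
    (hX : 3 * (D * (X.ncard + Z.ncard + 1)) ≤ (outerNeighbors G X).ncard)
    (hM : (t + 1) * l ≤ M) :
    ∃ x ∈ X, IsLarge (reach G (f ((t + 1) * l)) Z {x} ((t + 1) * l)) := by
  have hsub : outerNeighbors G X ⊆ reach G (f 0) Z X 0 ∪ Z := fun v hv ↦
    or_iff_not_imp_right.mpr fun hvZ ↦ ⟨hvZ, hv.2⟩
  have hcard : ((outerNeighbors G X).ncard : ℝ) ≤ (reach G (f 0) Z X 0).ncard + Z.ncard := by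
    exact_mod_cast (Set.ncard_le_ncard hsub).trans (Set.ncard_union_le _ _)
  have hXZ : (X.ncard + Z.ncard + 1 : ℝ) ≤ D * (X.ncard + Z.ncard + 1) :=
    le_mul_of_one_le_left (by positivity) hD
  have hX₀ : (0 : ℝ) ≤ X.ncard := by positivity
  have heq : (t + 1) * l = 0 + l + t * l := by ring
  rw [heq] at hM ⊢
  have hlarge := hf.isLarge_reach hβ hD hl (X := X) (Z := Z) (i := 0) (by linarith) (by omega)
  refine hf.exists_isLarge_reach_singleton hβ hD hl ?_ ?_ hlarge hM
  · rw [← Nat.card_eq_fintype_card] at ht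
    exact X.ncard_le_card.trans ht
  · linarith [ncard_le_card (outerNeighbors G X)]

end Growth

section Connecting

variable {W : Type*} {G : SimpleGraph W} {V : Set W} {L : ℝ} {m r : ℕ}

/-- `x` and `y` can be joined by a path of length at most `m` with all internal vertices in `N`. -/
def IsConnectingSet (G : SimpleGraph W) (m : ℕ) (x y : W) (N : Set W) : Prop :=
  ∃ P : G.Walk x y, P.IsPath ∧ P.length ≤ m ∧ ∀ v ∈ P.support, v = x ∨ v = y ∨ v ∈ N

theorem IsConnectingSet.exists_subset_ncard_le {x y : W} {N : Set W}
    (hN : IsConnectingSet G m x y N) : ∃ N' ⊆ N, N'.ncard ≤ m + 1 ∧ IsConnectingSet G m x y N' := by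
  classical
  obtain ⟨P, hP, hPm, hPN⟩ := hN
  refine ⟨{v | v ∈ P.support.toFinset ∧ v ∈ N}, fun v hv ↦ hv.2, ?_, P, hP, hPm, fun v hv ↦ ?_⟩
  · calc
      _ ≤ (P.support.toFinset : Set W).ncard :=
        Set.ncard_le_ncard (fun v hv ↦ hv.1) (Finset.finite_toSet _)
      _ ≤ P.support.length := by
        rw [Set.ncard_coe_finset]
        exact P.support.toFinset_card_le
      _ ≤ m + 1 := by
        rw [P.length_support]
        omega
  · exact (hPN v hv).imp_right (Or.imp_right fun h ↦ ⟨List.mem_toFinset.mpr hv, h⟩)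

/-- All families of distinct pairs of vertices outside `V` whose subsets expand by a factor `K`
can be joined by disjoint paths of length at most `L` through `V`. -/
def JoinsExpandingPairs (G : SimpleGraph W) (K L : ℝ) (V : Set W) : Prop :=
  ∀ (r : ℕ) (x y : Fin r → W), Function.Injective (Sum.elim x y) →
    (∀ i, x i ∉ V) → (∀ i, y i ∉ V) →
    (∀ X : Set W, X ⊆ Set.range x ∪ Set.range y →
      K * (X.ncard : ℝ) ≤ ((outerNeighbors G X).ncard : ℝ)) →
    JoinedThrough G V L x y

theorem joinedThrough_of_isConnectingSet {x y : Fin r → W} {N : Fin r → Set W} (hm : m ≤ L)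
    (hxy : Function.Injective (Sum.elim x y)) (hx : ∀ i, x i ∉ V) (hy : ∀ i, y i ∉ V)
    (hNV : ∀ i, N i ⊆ V) (hN : ∀ i, IsConnectingSet G m (x i) (y i) (N i))
    (hdisj : ∀ i j, i ≠ j → Disjoint (N i) (N j)) : JoinedThrough G V L x y := by
  choose P hP hPm hPN using hN
  refine ⟨P, hP, fun i ↦ (Nat.cast_le.mpr (hPm i)).trans hm,
    fun i v hv hvx hvy ↦ hNV i (((hPN i v hv).resolve_left hvx).resolve_left hvy),
    fun i j hij v hvi hvj ↦ ?_⟩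
  have hxx : x i ≠ x j := fun h ↦ hij (Sum.inl_injective (hxy h))
  have hyy : y i ≠ y j := fun h ↦ hij (Sum.inr_injective (hxy h))
  have hxy' (a b) : x a ≠ y b := fun h ↦ Sum.inl_ne_inr (hxy h)
  have hNij := Set.disjoint_left.mp (hdisj i j hij)
  grind

theorem exists_mem_and_of_two_mul_card_ge {ι : Type*} {S : Finset ι} {P Q : ι → Prop}
    (hP : ∀ X ⊆ S, S.card ≤ 2 * X.card → ∃ i ∈ X, P i)
    (hQ : ∀ X ⊆ S, S.card ≤ 2 * X.card → ∃ i ∈ X, Q i) : ∃ i ∈ S, P i ∧ Q i := by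
  classical
  have hfew {P : ι → Prop} (hP : ∀ X ⊆ S, S.card ≤ 2 * X.card → ∃ i ∈ X, P i) :
      2 * (S.filter (¬ P ·)).card < S.card := by
    by_contra! h
    obtain ⟨i, hi, hPi⟩ := hP _ (S.filter_subset _) h
    exact (Finset.mem_filter.mp hi).2 hPi
  by_contra! h
  have hsub : S ⊆ S.filter (¬ P ·) ∪ S.filter (¬ Q ·) := fun i hi ↦ by
    have := h i hi
    grind
  have := (Finset.card_le_card hsub).trans (Finset.card_union_le _ _)
  have := hfew hP
  have := hfew hQ
  omega

end Connecting

theorem three_mul_le_ncard_outerNeighbors {W ι : Type*} {G : SimpleGraph W} {D K : ℝ} {M : ℕ}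
    {S S' : Finset ι} {z : ι → W} {Z : Set W} (hD : 1 ≤ D) (hM : 1 ≤ M) (hK : 45 * D * M ≤ K)
    (hz : Function.Injective z)
    (hzN : ∀ X ⊆ Set.range z, K * X.ncard ≤ (outerNeighbors G X).ncard)
    (hS : S.Nonempty) (hSS' : S.card ≤ 2 * S'.card) (hZ : Z.ncard ≤ 6 * M * S.card) :
    3 * (D * ((z '' S').ncard + Z.ncard + 2)) ≤ (outerNeighbors G (z '' S')).ncard := by
  have hcard : (z '' S').ncard = S'.card := by
    rw [Set.ncard_image_of_injective _ hz, Set.ncard_coe_finset]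
  have hS' : 1 ≤ S'.card := by have := hS.card_pos; omega
  have hsize : S'.card + Z.ncard + 2 ≤ 15 * (M * S'.card) := by nlinarith
  have hsize' : (S'.card + Z.ncard + 2 : ℝ) ≤ 15 * (M * S'.card) := by exact_mod_cast hsize
  calc (3 * (D * ((z '' S').ncard + Z.ncard + 2)) : ℝ)
      ≤ 3 * (D * (15 * (M * S'.card))) := by rw [hcard]; gcongr
    _ = 45 * D * M * S'.card := by ring
    _ ≤ K * (z '' S').ncard := by rw [hcard]; gcongr
    _ ≤ _ := hzN _ (Set.image_subset_range _ _)

section Linkage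

variable {W ι : Type*} [Fintype W] {G : SimpleGraph W} {D β K L : ℝ} {M l t : ℕ}
  {f : ℕ → Set W} {Z : Set W} {S : Finset ι} {x y : ι → W}

theorem IsGoodChain.exists_isConnectingSet (hf : IsGoodChain G D β M f) (hβ : 0 ≤ β)
    (hD : 1 ≤ D) (hl : Fintype.card W ≤ β ^ l) (ht : Fintype.card W ≤ 2 ^ t)
    (hM : M = (t + 1) * l + 1) (hK : 45 * D * M ≤ K)
    (hx : Function.Injective x) (hy : Function.Injective y)
    (hxN : ∀ X ⊆ Set.range x, K * X.ncard ≤ (outerNeighbors G X).ncard)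
    (hyN : ∀ X ⊆ Set.range y, K * X.ncard ≤ (outerNeighbors G X).ncard)
    (hS : S.Nonempty) (hZ : Z.ncard ≤ 6 * M * S.card) :
    ∃ i ∈ S, IsConnectingSet G (2 * M) (x i) (y i) (f M \ Z) := by
  set m := (t + 1) * l
  have hm : m < M := by omega
  have hM₁ : 1 ≤ M := by omega
  have hlarge {z : ι → W} (hz : Function.Injective z)
      (hzN : ∀ X ⊆ Set.range z, K * X.ncard ≤ (outerNeighbors G X).ncard) :
      ∀ S' ⊆ S, S.card ≤ 2 * S'.card → ∃ i ∈ S', IsLarge (reach G (f m) Z {z i} m) := by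
    intro S' _ hSS'
    obtain ⟨_, ⟨i, hi, rfl⟩, hzi⟩ := hf.exists_mem_isLarge_reach hβ hD hl ht
      ((three_mul_le_ncard_outerNeighbors hD hM₁ hK hz hzN hS hSS' hZ).trans' (by
        gcongr
        norm_num)) hm.le
    exact ⟨i, hi, hzi⟩
  obtain ⟨i, hi, hxi, hyi⟩ :=
    exists_mem_and_of_two_mul_card_ge (hlarge hx hxN) (hlarge hy hyN)
  have hsmall : D * (({x i} : Set W).ncard + ({y i} : Set W).ncard + Z.ncard + 1) ≤
      Fintype.card W / 3 := by
    have h := three_mul_le_ncard_outerNeighbors (S' := S) hD hM₁ hK hx hxN hS (by omega) hZ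
    have hS₁ : (1 : ℝ) ≤ (x '' S).ncard := by
      rw [Set.ncard_image_of_injective _ hx, Set.ncard_coe_finset]
      exact_mod_cast hS.card_pos
    have hle : D * (3 + Z.ncard) ≤ D * ((x '' S).ncard + Z.ncard + 2) :=
      mul_le_mul_of_nonneg_left (by linarith) (by linarith)
    simp only [Set.ncard_singleton, Nat.cast_one]
    linarith [ncard_le_card (outerNeighbors G (x '' S))]
  obtain ⟨hsub, hstep⟩ := hf m hm
  rw [← hM] at hsub hstep
  obtain ⟨u, ⟨hux, huy⟩, hu⟩ := Set.not_disjoint_iff.mp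
    (hstep.hit {x i} {y i} Z (hsmall.trans (hxi.card_div_three_lt_ncard_inter hyi).le))
  obtain ⟨P, hP, hPm, hPs⟩ := exists_path_of_mem_reach (reach_mono hsub hux)
    (reach_mono hsub huy) hu
  exact ⟨i, hi, P, hP, hM ▸ hPm, hPs⟩

theorem IsGoodChain.haxellCondition (hf : IsGoodChain G D β M f) (hβ : 0 ≤ β)
    (hD : 1 ≤ D) (hl : Fintype.card W ≤ β ^ l) (ht : Fintype.card W ≤ 2 ^ t)
    (hM : M = (t + 1) * l + 1) (hK : 45 * D * M ≤ K)
    (hx : Function.Injective x) (hy : Function.Injective y)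
    (hxN : ∀ X ⊆ Set.range x, K * X.ncard ≤ (outerNeighbors G X).ncard)
    (hyN : ∀ X ⊆ Set.range y, K * X.ncard ≤ (outerNeighbors G X).ncard) :
    HaxellCondition
      (fun i ↦ {N : {N : Set W // N.ncard ≤ 2 * M + 1} |
        N.1 ⊆ f M ∧ IsConnectingSet G (2 * M) (x i) (y i) N.1})
      (fun N N' ↦ ¬ Disjoint N.1 N'.1) := by
  intro S T hS hT
  set Z : Set W := ⋃ N ∈ T, N.1
  have hZ : Z.ncard ≤ 6 * M * S.card :=
    calc
      Z.ncard ≤ ∑ N ∈ T, N.1.ncard := T.set_ncard_biUnion_le _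
      _ ≤ T.card * (2 * M + 1) := T.sum_le_card_nsmul _ _ fun N _ ↦ N.2
      _ ≤ (2 * S.card) * (3 * M) := Nat.mul_le_mul (by omega) (by omega)
      _ = 6 * M * S.card := by ring
  obtain ⟨i, hi, hN⟩ := hf.exists_isConnectingSet hβ hD hl ht hM hK hx hy hxN hyN hS hZ
  obtain ⟨N, hNsub, hNcard, hN⟩ := hN.exists_subset_ncard_le
  have hNZ : Disjoint N Z := Set.disjoint_left.mpr fun v hv ↦ (hNsub hv).2
  exact ⟨i, hi, ⟨N, hNcard⟩, ⟨hNsub.trans Set.sdiff_subset, hN⟩, fun N' hN' ↦ not_not.mpr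
    (hNZ.symm.mono_left (Set.subset_biUnion_of_mem (u := fun N : {N : Set W // _} ↦ N.1) hN'))⟩

theorem IsGoodChain.joinsExpandingPairs (hf : IsGoodChain G D β M f) (hβ : 0 ≤ β)
    (hD : 1 ≤ D) (hl : Fintype.card W ≤ β ^ l) (ht : Fintype.card W ≤ 2 ^ t)
    (hM : M = (t + 1) * l + 1) (hK : 45 * D * M ≤ K) (hL : 2 * M ≤ L) :
    JoinsExpandingPairs G K L (f M) := by
  intro r x y hxy hx hy hN
  have hsymm : Std.Symm fun N N' : {N : Set W // N.ncard ≤ 2 * M + 1} ↦ ¬ Disjoint N.1 N'.1 :=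
    ⟨fun _ _ h ↦ mt (Disjoint.symm ·) h⟩
  obtain ⟨T, hT, hdisj⟩ := (hf.haxellCondition hβ hD hl ht hM hK
    (hxy.comp Sum.inl_injective) (hxy.comp Sum.inr_injective)
    (fun X hX ↦ hN X (hX.trans Set.subset_union_left))
    (fun X hX ↦ hN X (hX.trans Set.subset_union_right))).exists_transversal
  exact joinedThrough_of_isConnectingSet (by exact_mod_cast hL) hxy hx hy
    (fun i ↦ (hT i).1) (fun i ↦ (hT i).2) fun i j hij ↦ not_not.mp (hdisj i j hij)

end Linkage

section RandomLinkage

variable {W : Type*} [Fintype W] {G : SimpleGraph W} {D K L α s x y : ℝ} {M l t : ℕ} {p q : I}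

theorem IsRobustExpander.le_setBernoulli_real_joinsExpandingPairs (hG : IsRobustExpander G α s)
    (hα₀ : 0 < α) (hα₁ : α ≤ 1) (hp : 0 < (p : ℝ)) (hps : 1 / (p : ℝ) ≤ s) (hD : 4 ≤ α * D)
    (hy : Real.exp (-(α ^ 2 * p ^ 2 / 512 * D)) ≤ y) (hny : 3 * Fintype.card W * y ≤ 1 / 2)
    (hl : Fintype.card W ≤ (1 + α / 32) ^ l) (ht : Fintype.card W ≤ 2 ^ t)
    (hM : M = (t + 1) * l + 1) (hq : σ q = σ p ^ M) (hK : 45 * D * M ≤ K) (hL : 2 * M ≤ L) :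
    1 - M * (4 * y) ≤ setBer(Set.univ, q).real {V | JoinsExpandingPairs G K L V} := by
  have hD₁ : 1 ≤ D := by by_contra! hD'; nlinarith
  have hy₀ : 0 ≤ y := (Real.exp_pos _).le.trans hy
  have hfail := setBernoulli_real_not_exists_isGoodChain_le (by positivity)
    (hG.setBernoulli_real_not_isGoodStep_le hα₀ hα₁ hp hps hD hy hny) hq
  rw [← Set.compl_ofPred, probReal_compl_eq_one_sub (Set.toFinite _).measurableSet] at hfail
  refine (sub_le_comm.mp hfail).trans (measureReal_mono ?_)
  rintro _ ⟨f, hf, rfl⟩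
  exact hf.joinsExpandingPairs (by positivity) hD₁ hl ht hM hK hL

theorem exists_symm_pow_eq_symm (q : I) (hM : M ≠ 0) :
    ∃ p : I, σ q = σ p ^ M ∧ (q : ℝ) ≤ M * p := by
  have hq : 0 ≤ 1 - (q : ℝ) := sub_nonneg.mpr q.2.2
  set b : I := ⟨(1 - q : ℝ) ^ (M : ℝ)⁻¹, Real.rpow_nonneg hq _,
    Real.rpow_le_one hq (by linarith [q.2.1]) (by positivity)⟩
  have hb : (1 - q : ℝ) = b ^ M := (Real.rpow_inv_natCast_pow hq hM).symm
  refine ⟨σ b, Subtype.ext (by simpa using hb), ?_⟩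
  have := one_add_mul_le_pow (a := (b : ℝ) - 1) (by linarith [b.2.1]) M
  rw [add_sub_cancel, ← hb] at this
  rw [coe_symm_eq]
  linarith

theorem exists_two_rpow_le_pow (hα₀ : 0 < α) (hα₁ : α ≤ 1) (hx : 2 ≤ x) :
    ∃ l t : ℕ, (2 : ℝ) ^ x ≤ (1 + α / 32) ^ l ∧ (2 : ℝ) ^ x ≤ 2 ^ t ∧
      ((t + 1) * l + 1 : ℝ) ≤ 100 * x ^ 2 / α := by
  set k := ⌈32 / α⌉₊
  set t := ⌈x⌉₊
  have hk : 32 / α ≤ k := Nat.le_ceil _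
  have hk' : (k : ℝ) < 33 / α := by
    refine (Nat.ceil_lt_add_one (by positivity)).trans_le ?_
    rw [div_add_one hα₀.ne']
    gcongr
    linarith
  have ht : (t : ℝ) < x + 1 := Nat.ceil_lt_add_one (by linarith)
  have hxt : (2 : ℝ) ^ x ≤ 2 ^ t := by
    rw [← Real.rpow_natCast]
    exact Real.rpow_le_rpow_of_exponent_le one_le_two (Nat.le_ceil x)
  have hkpow : 2 ≤ (1 + α / 32) ^ k :=
    calc
      2 ≤ 1 + k * (α / 32) := by
        rw [div_le_iff₀ hα₀] at hk
        linarith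
      _ ≤ (1 + α / 32) ^ k := one_add_mul_le_pow (by linarith) k
  refine ⟨k * t, t, hxt.trans ?_, hxt, ?_⟩
  · rw [pow_mul]
    gcongr
  · have hle : (t + 1 : ℝ) * (k * t) ≤ 99 * x ^ 2 / α :=
      calc
        _ ≤ (2 * x) * (33 / α * (3 / 2 * x)) := by gcongr <;> linarith
        _ = 99 * x ^ 2 / α := by ring
    have hone : 1 ≤ x ^ 2 / α := by
      rw [one_le_div hα₀]
      nlinarith
    push_cast
    linarith [show 100 * x ^ 2 / α = 99 * x ^ 2 / α + x ^ 2 / α by ring]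

theorem joinsExpandingPairs_of_card_lt (hK : Fintype.card W < K) (V : Set W) :
    JoinsExpandingPairs G K L V := by
  rintro (_ | r) x y - - - hN
  · exact ⟨nofun, nofun, nofun, nofun, nofun⟩
  · have hle := hN {x 0} (Set.singleton_subset_iff.mpr (.inl ⟨0, rfl⟩))
    rw [Set.ncard_singleton, Nat.cast_one, mul_one] at hle
    linarith [ncard_le_card (outerNeighbors G {x 0})]

theorem exp_neg_three_mul_logb_le {n : ℝ} (hn : 1 ≤ n) :
    Real.exp (-(3 * Real.logb 2 n)) ≤ 1 / n ^ 3 := by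
  have hlog : Real.log n ≤ Real.logb 2 n :=
    le_div_self (Real.log_nonneg hn) (Real.log_pos one_lt_two)
      (by linarith [Real.log_two_lt_d9])
  calc
    Real.exp (-(3 * Real.logb 2 n)) ≤ Real.exp (-(3 * Real.log n)) := by gcongr
    _ = 1 / n ^ 3 := by
      rw [Real.exp_neg, one_div, show 3 * Real.log n = (3 : ℕ) * Real.log n by norm_num,
        Real.exp_nat_mul, Real.exp_log (by linarith)]

theorem four_le_and_eq_two_rpow_logb {n : ℕ} (hn : 2 ≤ Real.logb 2 n) :
    4 ≤ n ∧ (n : ℝ) = 2 ^ Real.logb 2 n := by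
  have hn₀ : (0 : ℝ) < n := by
    refine Nat.cast_pos.mpr (Nat.pos_of_ne_zero ?_)
    rintro rfl
    norm_num at hn
  have hn₄ : (2 : ℝ) ^ (2 : ℝ) ≤ n := (Real.le_logb_iff_rpow_le one_lt_two hn₀).mp hn
  refine ⟨?_, (Real.rpow_logb two_pos (by norm_num) hn₀).symm⟩
  norm_num at hn₄
  exact_mod_cast hn₄

theorem exists_sampling_parameters (hα₀ : 0 < α) (hα₁ : α ≤ 1) (hq : 0 < (q : ℝ)) (hx : 1 ≤ x)
    (hM₀ : M ≠ 0) (hM : M ≤ 100 * x ^ 2 / α) :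
    ∃ (p : I) (D : ℝ), σ q = σ p ^ M ∧ 0 < (p : ℝ) ∧ 1 / (p : ℝ) ≤ 100 * x ^ 2 / (α * q) ∧
      4 ≤ α * D ∧ α ^ 2 * p ^ 2 / 512 * D = 3 * x ∧
      45 * D * M ≤ 10 ^ 11 * x ^ 7 / (α ^ 5 * q ^ 2) := by
  obtain ⟨p, hqp, hqM⟩ := exists_symm_pow_eq_symm q hM₀
  have hp : 0 < (p : ℝ) := pos_of_mul_pos_right (hq.trans_le hqM) (Nat.cast_nonneg M)
  have hp' : 1 / (p : ℝ) ≤ 100 * x ^ 2 / (α * q) :=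
    calc
      1 / (p : ℝ) ≤ M / q := by
        rw [div_le_div_iff₀ hp hq]
        linarith
      _ ≤ 100 * x ^ 2 / α / q := by gcongr
      _ = 100 * x ^ 2 / (α * q) := div_div _ _ _
  refine ⟨p, 1536 * x / (α ^ 2 * p ^ 2), hqp, hp, hp', ?_, by field_simp; norm_num, ?_⟩
  · have hαp : α * p ^ 2 ≤ 1 := mul_le_one₀ hα₁ (by positivity) (pow_le_one₀ hp.le p.2.2)
    calc
      4 ≤ 1536 * x / (α * p ^ 2) := by
        rw [le_div_iff₀ (by positivity)]
        linarith
      _ = α * (1536 * x / (α ^ 2 * p ^ 2)) := by field_simp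
  · calc
      _ = 69120 * x * (1 / p : ℝ) ^ 2 / α ^ 2 * M := by ring
      _ ≤ 69120 * x * (100 * x ^ 2 / (α * q)) ^ 2 / α ^ 2 * (100 * x ^ 2 / α) := by gcongr
      _ = 69120000000 * x ^ 7 / (α ^ 5 * q ^ 2) := by field_simp; norm_num
      _ ≤ 10 ^ 11 * x ^ 7 / (α ^ 5 * q ^ 2) := by gcongr; norm_num

theorem IsRobustExpander.one_sub_one_div_le_setBernoulli_real_joinsExpandingPairs
    (hG : IsRobustExpander G α s) (hα₀ : 0 < α) (hα₁ : α ≤ 1) (hq : 0 < (q : ℝ))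
    (hx : x = Real.logb 2 (Fintype.card W)) (hx₂ : 2 ≤ x) (hs : 100 * x ^ 2 / (α * q) ≤ s)
    (hK : 10 ^ 11 * x ^ 7 / (α ^ 5 * q ^ 2) ≤ K) (hL : 200 * x ^ 2 / α ≤ L) :
    1 - 1 / (Fintype.card W : ℝ) ≤
      setBer(Set.univ, q).real {V | JoinsExpandingPairs G K L V} := by
  obtain hKn | hKn := lt_or_ge (Fintype.card W : ℝ) K
  · have huniv : {V | JoinsExpandingPairs G K L V} = Set.univ :=
      Set.eq_univ_of_forall (joinsExpandingPairs_of_card_lt hKn)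
    rw [huniv, probReal_univ]
    exact sub_le_self 1 (by positivity)
  obtain ⟨hn₄, hnx⟩ := four_le_and_eq_two_rpow_logb (hx ▸ hx₂)
  have hn : (4 : ℝ) ≤ Fintype.card W := by exact_mod_cast hn₄
  obtain ⟨l, t, hl, ht, hM⟩ := exists_two_rpow_le_pow hα₀ hα₁ hx₂
  rw [hx, ← hnx] at hl ht
  obtain ⟨M, hMlt⟩ : ∃ M, M = (t + 1) * l + 1 := ⟨_, rfl⟩
  replace hM : M ≤ 100 * x ^ 2 / α := by simpa [hMlt] using hM
  obtain ⟨p, D, hqp, hp, hp', hαD, hDx, hDM⟩ :=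
    exists_sampling_parameters hα₀ hα₁ hq (by linarith) (by omega) hM
  have hMn : (M : ℝ) ≤ Fintype.card W := by
    have hD : 1 ≤ D := by by_contra! hD; nlinarith
    nlinarith
  have hy : Real.exp (-(α ^ 2 * p ^ 2 / 512 * D)) ≤ 1 / Fintype.card W ^ 3 := by
    rw [hDx, hx]
    exact exp_neg_three_mul_logb_le (by linarith)
  refine (sub_le_sub_left ?_ 1).trans (hG.le_setBernoulli_real_joinsExpandingPairs hα₀ hα₁ hp
    (hp'.trans hs) hαD hy ?_ hl (by exact_mod_cast ht) hMlt hqp (hDM.trans hK) (hL.trans' ?_))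
  · calc
      M * (4 * (1 / Fintype.card W ^ 3 : ℝ)) ≤
          Fintype.card W * (Fintype.card W * (1 / Fintype.card W ^ 3)) := by gcongr
      _ = 1 / Fintype.card W := by field_simp
  · rw [mul_one_div, div_le_div_iff₀ (by positivity) two_pos]
    nlinarith [pow_le_pow_left₀ (by norm_num) hn 2]
  · linarith [show 200 * x ^ 2 / α = 2 * (100 * x ^ 2 / α) by ring]

end RandomLinkage

section Logarithms

theorem exists_forall_le_logb_natCast (C : ℝ) : ∃ n₀ : ℕ, ∀ n ≥ n₀, C ≤ Real.logb 2 (n : ℝ) :=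
  Filter.eventually_atTop.mp (((Real.tendsto_logb_atTop one_lt_two).comp
    tendsto_natCast_atTop_atTop).eventually_ge_atTop C)

theorem rpow_natCast_mul_add_natCast {x : ℝ} (hx : 0 < x) (c : ℝ) (a b : ℕ) :
    x ^ (a * c + b) = (x ^ c) ^ a * x ^ b := by
  rw [Real.rpow_add hx, Real.rpow_natCast, mul_comm (a : ℝ), Real.rpow_mul_natCast hx.le]

theorem pow_mul_pow_div_pow_le {A x q : ℝ} (hA : 1 ≤ A) (hx : 1 ≤ x) (hq₀ : 0 < q) (hq₁ : q ≤ 1)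
    {a a' b b' d d' : ℕ} (ha : a ≤ a') (hb : b ≤ b') (hd : d ≤ d') :
    A ^ a * x ^ b / q ^ d ≤ A ^ a' * x ^ b' / q ^ d' :=
  div_le_div₀ (by positivity) (by gcongr) (by positivity)
    (pow_le_pow_of_le_one hq₀.le hq₁ hd)

theorem IsRobustExpander.one_sub_one_div_le_setBernoulli_real_of_le_logb {W : Type*} [Fintype W]
    {G : SimpleGraph W} {κ A s x : ℝ} {q : I} (hG : IsRobustExpander G (1 / (κ * A)) s)
    (hκ : 1 ≤ κ) (hA : 1 ≤ A) (hq : 0 < (q : ℝ)) (hx : x = Real.logb 2 (Fintype.card W))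
    (hκx : 1000 * κ ≤ x) (hs : 2 * (A ^ 9 * x ^ 21) / (q : ℝ) ^ 10 ≤ s) :
    1 - 1 / (Fintype.card W : ℝ) ≤ setBer(Set.univ, q).real
      {V | JoinsExpandingPairs G (100 * (A ^ 7 * x ^ 19) / (q : ℝ) ^ 6) (A * x ^ 4) V} := by
  have hx₁ : 1 ≤ x := by linarith
  have hs' : 100 * x ^ 2 / (1 / (κ * A) * q) ≤ 2 * (A ^ 9 * x ^ 21) / (q : ℝ) ^ 10 :=
    calc
      _ = 100 * κ * (A ^ 1 * x ^ 2 / (q : ℝ) ^ 1) := by field_simp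
      _ ≤ (2 * x) * (A ^ 9 * x ^ 20 / (q : ℝ) ^ 10) :=
        mul_le_mul (by linarith) (pow_mul_pow_div_pow_le hA hx₁ hq q.2.2 (by simp) (by simp)
          (by simp)) (by positivity) (by positivity)
      _ = 2 * (A ^ 9 * x ^ 21) / (q : ℝ) ^ 10 := by ring
  have hκx₅ : 1000 ^ 5 * κ ^ 5 ≤ x ^ 5 := by
    rw [← mul_pow]
    gcongr
  have hK : 10 ^ 11 * x ^ 7 / ((1 / (κ * A)) ^ 5 * q ^ 2) ≤
      100 * (A ^ 7 * x ^ 19) / (q : ℝ) ^ 6 :=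
    calc
      _ = 10 ^ 11 * κ ^ 5 * (A ^ 5 * x ^ 7 / (q : ℝ) ^ 2) := by field_simp
      _ ≤ (100 * x ^ 5) * (A ^ 7 * x ^ 14 / (q : ℝ) ^ 6) :=
        mul_le_mul (by linarith [pow_pos (zero_lt_one.trans_le hκ) 5])
          (pow_mul_pow_div_pow_le hA hx₁ hq q.2.2 (by simp) (by simp) (by simp))
          (by positivity) (by positivity)
      _ = 100 * (A ^ 7 * x ^ 19) / (q : ℝ) ^ 6 := by ring
  have hL : 200 * x ^ 2 / (1 / (κ * A)) ≤ A * x ^ 4 :=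
    calc
      _ = 200 * κ * (A * x ^ 2) := by field_simp
      _ ≤ x ^ 2 * (A * x ^ 2) := by
        gcongr
        nlinarith
      _ = A * x ^ 4 := by ring
  have hα : 1 / (κ * A) ≤ 1 :=
    div_le_one_of_le₀ (one_le_mul_of_one_le_of_one_le hκ hA) (by positivity)
  exact hG.one_sub_one_div_le_setBernoulli_real_joinsExpandingPairs (by positivity) hα hq hx
    (by linarith) (hs'.trans hs) hK hL

end Logarithms

end SublinearExpander

theorem mainTheorem4_general (ε₀ : ℝ) (hε₀ : 0 < ε₀) :
    ∃ n₀ : ℕ, ∀ (W : Type*) [Fintype W] (G : SimpleGraph W) (ε c s : ℝ) (q : unitInterval),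
      n₀ ≤ Fintype.card W → ε₀ ≤ ε → 0 ≤ c → 0 < (q : ℝ) →
      2 * Real.logb 2 (Fintype.card W) ^ (9 * c + 21) / (q : ℝ) ^ 10 ≤ s →
      SublinearExpander.IsExpander G ε c s →
      1 - 1 / (Fintype.card W : ℝ) ≤
        (ProbabilityTheory.setBernoulli (Set.univ : Set W) q).real
          {V | SublinearExpander.JoinsExpandingPairs G
            (100 * Real.logb 2 (Fintype.card W) ^ (7 * c + 19) / (q : ℝ) ^ 6)
            (Real.logb 2 (Fintype.card W) ^ (c + 4)) V} := by
  set κ := max 1 (1 / ε₀)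
  have hκ : 1 ≤ κ := le_max_left _ _
  obtain ⟨n₀, hn₀⟩ := SublinearExpander.exists_forall_le_logb_natCast (1000 * κ)
  refine ⟨n₀, fun W _ G ε c s q hn hε hc hq hs hG ↦ ?_⟩
  have hκx := hn₀ _ hn
  set x := Real.logb 2 (Fintype.card W : ℝ) with hx
  have hx₁ : 1 ≤ x := by linarith
  set A := x ^ c
  have hA : 1 ≤ A := Real.one_le_rpow hx₁ hc
  have hrpow := SublinearExpander.rpow_natCast_mul_add_natCast (by linarith : 0 < x) c
  have hrpow₄ : x ^ (c + 4) = A * x ^ 4 := by simpa using hrpow 1 4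
  have hrpow₁₉ : x ^ (7 * c + 19) = A ^ 7 * x ^ 19 := hrpow 7 19
  have hrpow₂₁ : x ^ (9 * c + 21) = A ^ 9 * x ^ 21 := hrpow 9 21
  rw [hrpow₂₁] at hs
  rw [hrpow₄, hrpow₁₉]
  have hαε : 1 / (κ * A) ≤ ε / A := by
    rw [← div_div]
    gcongr
    exact ((one_div_le (by positivity) hε₀).mpr (le_max_right _ _)).trans hε
  exact (hG.isRobustExpander.mono hαε).one_sub_one_div_le_setBernoulli_real_of_le_logb hκ hA hq hx
    hκx hs

theorem mainTheorem4 :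
    ∃ n₀ : ℕ, ∀ (W : Type*) [Fintype W] (G : SimpleGraph W) (ε c s : ℝ) (q : unitInterval),
      n₀ ≤ Fintype.card W →
      (2 : ℝ) ^ (-9 : ℤ) ≤ ε → ε < 1 → 0 < c → 0 < (q : ℝ) → (q : ℝ) < 1 →
      2 * (Real.logb 2 (Fintype.card W : ℝ)) ^ (9 * c + 21) / (q : ℝ) ^ 10 ≤ s →
      SublinearExpander.IsExpander G ε c s →
      1 - 1 / (Fintype.card W : ℝ) ≤
        (ProbabilityTheory.setBernoulli (Set.univ : Set W) q).real
          {V : Set W | ∀ (r : ℕ) (x y : Fin r → W),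
            Function.Injective (Sum.elim x y) →
            (∀ i, x i ∉ V) → (∀ i, y i ∉ V) →
            (∀ X : Set W, X ⊆ Set.range x ∪ Set.range y →
              100 * (Real.logb 2 (Fintype.card W : ℝ)) ^ (7 * c + 19) / (q : ℝ) ^ 6 *
                  (X.ncard : ℝ) ≤
                ((SublinearExpander.outerNeighbors G X).ncard : ℝ)) →
            SublinearExpander.JoinedThrough G V
              ((Real.logb 2 (Fintype.card W : ℝ)) ^ (c + 4)) x y} := by
  obtain ⟨n₀, hn₀⟩ := mainTheorem4_general ((2 : ℝ) ^ (-9 : ℤ)) (by positivity)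
  exact ⟨n₀, fun W _ G ε c s q hn hε _ hc hq _ ↦ hn₀ W G ε c s q hn hε hc.le hq⟩
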